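/- Let $M$ be a $2$-dimensional smooth manifold and $F$ a Finsler metric on $M$, i.e. a function $F:TM\to[0,\infty)$ that is $C^\infty$ on $TM_0=TM\setminus\{0\}$, positively homogeneous of degree one on the fibres, and such that $g_{ij}=\frac12\frac{\partial^2F^2}{\partial y^i\partial y^j}$ is positive definite on $TM_0$. Let $C_{ijk}=\frac12\frac{\partial g_{ij}}{\partial y^k}$ be the Cartan torsion, $L_{ijk}=C_{ijk|s}y^s$ the Landsberg curvature and $\Sigma_{ijkl}=2(L_{ijk|l}-L_{ijl|k})$ the stretch curvature, where "$|$" is the horizontal covariant derivative of the Berwald connection of $F$. Suppose that $F$ has relatively isotropic stretch curvature $c$, i.e. there is a function $c=c(x)$ on $M$ with $$\Sigma_{ijkl}=c\,F\,(C_{ijk|l}-C_{ijl|k})\quad\text{on } TM_0 .$$ Let $(\ell,m)$ be a local Berwald frame, that is $\ell^i=y^i/F$, $g_{ij}\ell^im^j=0$, $g_{ij}m^im^j=1$, and let $I$ be the principal scalar, defined (up to the sign given by the choice of $m$) by $C_{ijk}=F^{-1}I\,m_im_jm_k$ with $m_i=g_{ij}m^j$. On the open set $\{I\neq0\}\subset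 TM_0$ put $\mu=I^{-1}I_{|1}$, where $I_{|1}=I_{|s}\ell^s$, and $\mu'=\mu_{|s}y^s$ (neither depends on the choice of $m$). Then $F$ is Riemannian, i.e. $F(x,y)=\sqrt{a_x(y,y)}$ for a smooth Riemannian metric $a$ on $M$, if and only if $$2\mu'+2\mu^2F-c\,\mu F\neq0$$ at every point of $TM_0$ with $I\neq0$ (that is, at every point at which the left-hand side is defined). More precisely, $2\mu'+2\mu^2F-c\,\mu F=0$ at every point of $TM_0$ with $I\neq0$, so that the condition can hold only if $I$ vanishes identically. -/

import Mathlib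

open scoped Manifold ContDiff Bundle

noncomputable section

namespace Finsler

/-- A Finsler metric on the `n`-dimensional smooth manifold `M`: a nonnegative function on `TM`,
`C^∞` on the slit tangent bundle `TM₀`, positively homogeneous of degree one on the fibres, and
such that for all `y ≠ 0` in `T_x M` the form
`g_y(u, v) = (1/2) ∂²/∂s∂t F²(y + s u + t v)` (at `s = t = 0`) is positive definite. -/
structure FinslerMetric (n : ℕ) (M : Type*) [TopologicalSpace M]
    [ChartedSpace (EuclideanSpace ℝ (Fin n)) M] [IsManifold (𝓡 n) ∞ M] where
  toFun : TangentBundle (𝓡 n) M → ℝ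
  nonneg : ∀ p, 0 ≤ toFun p
  smooth : ContMDiffOn (𝓡 n).tangent 𝓘(ℝ, ℝ) ∞ toFun {p | p.2 ≠ 0}
  homogeneous : ∀ (x : M) (y : TangentSpace (𝓡 n) x) (r : ℝ), 0 < r →
    toFun ⟨x, r • y⟩ = r * toFun ⟨x, y⟩
  posDef : ∀ (x : M) (y u : TangentSpace (𝓡 n) x), y ≠ 0 → u ≠ 0 →
    0 < (1 / 2 : ℝ) * deriv (fun s : ℝ => deriv (fun t : ℝ =>
      toFun ⟨x, y + s • u + t • u⟩ ^ 2) 0) 0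

/-! ### Local calculus

Here `f : V n → V n → ℝ` is the expression `f x y` of a Finsler metric in local coordinates:
`x` are the coordinates of the base point, `y` the components of the tangent vector. -/

/-- The coordinate space `ℝⁿ`. -/
abbrev V (n : ℕ) : Type := EuclideanSpace ℝ (Fin n)

variable {n : ℕ}

/-- `∂h/∂xⁱ`. -/
def dX (i : Fin n) (h : V n → V n → ℝ) : V n → V n → ℝ := fun x y =>
  fderiv ℝ (fun z => h z y) x (EuclideanSpace.single i 1)

/-- `∂h/∂yⁱ`. -/
def dY (i : Fin n) (h : V n → V n → ℝ) : V n → V n → ℝ := fun x y =>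
  fderiv ℝ (fun z => h x z) y (EuclideanSpace.single i 1)

/-- The fundamental tensor `g_ij = (1/2) ∂²F²/∂yⁱ∂yʲ`. -/
def fundamentalTensor (f : V n → V n → ℝ) (i j : Fin n) : V n → V n → ℝ := fun x y =>
  (1 / 2 : ℝ) * dY i (dY j (fun x' y' => f x' y' ^ 2)) x y

/-- The matrix `(g_ij)` at the point `(x, y)`. -/
def gMatrix (f : V n → V n → ℝ) (x y : V n) : Matrix (Fin n) (Fin n) ℝ :=
  Matrix.of fun i j => fundamentalTensor f i j x y

/-- The Cartan torsion `C_ijk = (1/2) ∂g_ij/∂yᵏ`. -/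
def cartan (f : V n → V n → ℝ) (i j k : Fin n) : V n → V n → ℝ := fun x y =>
  (1 / 2 : ℝ) * dY k (fundamentalTensor f i j) x y

/-- The spray coefficients
`Gⁱ = (1/4) gⁱˡ (∂²F²/∂xᵏ∂yˡ yᵏ - ∂F²/∂xˡ)`. -/
def spray (f : V n → V n → ℝ) (i : Fin n) : V n → V n → ℝ := fun x y =>
  (1 / 4 : ℝ) * ∑ l, (gMatrix f x y)⁻¹ i l *
    ((∑ k, dX k (dY l (fun x' y' => f x' y' ^ 2)) x y * y k)
      - dX l (fun x' y' => f x' y' ^ 2) x y)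

/-- The nonlinear connection `Nⁱ_j = ∂Gⁱ/∂yʲ`. -/
def nonlinConn (f : V n → V n → ℝ) (i j : Fin n) : V n → V n → ℝ := dY j (spray f i)

/-- The coefficients `Γⁱ_jk = ∂²Gⁱ/∂yʲ∂yᵏ` of the Berwald connection. -/
def berwaldConn (f : V n → V n → ℝ) (i j k : Fin n) : V n → V n → ℝ := dY j (dY k (spray f i))

/-- The horizontal derivative `h_{|k} = ∂h/∂xᵏ - Nᵐ_k ∂h/∂yᵐ` of a scalar function `h`. -/
def horiz (f : V n → V n → ℝ) (k : Fin n) (h : V n → V n → ℝ) : V n → V n → ℝ := fun x y =>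
  dX k h x y - ∑ m, nonlinConn f m k x y * dY m h x y

/-- The horizontal covariant derivative `T_{ijk|l}`, with respect to the Berwald connection, of a
covariant tensor `T_ijk`. -/
def covDeriv (f : V n → V n → ℝ) (T : Fin n → Fin n → Fin n → V n → V n → ℝ)
    (i j k l : Fin n) : V n → V n → ℝ := fun x y =>
  horiz f l (T i j k) x y
    - ∑ m, berwaldConn f m i l x y * T m j k x y
    - ∑ m, berwaldConn f m j l x y * T i m k x y
    - ∑ m, berwaldConn f m k l x y * T i j m x y

/-- The Landsberg curvature `L_ijk = C_{ijk|s} yˢ`. -/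
def landsberg (f : V n → V n → ℝ) (i j k : Fin n) : V n → V n → ℝ := fun x y =>
  ∑ s, covDeriv f (cartan f) i j k s x y * y s

/-- The stretch curvature `Σ_ijkl = 2 (L_{ijk|l} - L_{ijl|k})`. -/
def stretch (f : V n → V n → ℝ) (i j k l : Fin n) : V n → V n → ℝ := fun x y =>
  2 * (covDeriv f (landsberg f) i j k l x y - covDeriv f (landsberg f) i j l k x y)

/-! ### The Berwald frame in dimension two -/

/-- The covector `ℓ_i = g_ij yʲ / F`. -/
def ellLower (f : V 2 → V 2 → ℝ) (i : Fin 2) (x y : V 2) : ℝ :=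
  ∑ j, fundamentalTensor f i j x y * (y j / f x y)

/-- The second vector `m = (-ℓ_2, ℓ_1) / √(det g)` of the Berwald frame `(ℓ, m)`, `ℓⁱ = yⁱ/F`. It
is the vector with `ℓ_i mⁱ = 0` and `g_ij mⁱ mʲ = 1` for which `(ℓ, m)` is positively oriented in
the given coordinates; the only other such unit vector is `-m`, and choosing it replaces the
principal scalar by its negative and does not change `logDerivScalar`. -/
def berwaldM (f : V 2 → V 2 → ℝ) (x y : V 2) : Fin 2 → ℝ :=
  ![-ellLower f 1 x y / √((gMatrix f x y).det), ellLower f 0 x y / √((gMatrix f x y).det)]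

/-- The principal scalar `I`, determined by `C_ijk = F⁻¹ I m_i m_j m_k`,
that is `I = F C_ijk mⁱ mʲ mᵏ`. -/
def principalScalar (f : V 2 → V 2 → ℝ) : V 2 → V 2 → ℝ := fun x y =>
  f x y * ∑ i, ∑ j, ∑ k, cartan f i j k x y *
    berwaldM f x y i * berwaldM f x y j * berwaldM f x y k

/-- `μ = I⁻¹ I_{|1}`, where `I_{|1} = I_{|s} ℓˢ`; meaningful where `I ≠ 0`. -/
def logDerivScalar (f : V 2 → V 2 → ℝ) : V 2 → V 2 → ℝ := fun x y =>
  (principalScalar f x y)⁻¹ * ∑ s, horiz f s (principalScalar f) x y * (y s / f x y)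

/-- `μ' = μ_{|s} yˢ`. -/
def logDerivScalar' (f : V 2 → V 2 → ℝ) : V 2 → V 2 → ℝ := fun x y =>
  ∑ s, horiz f s (logDerivScalar f) x y * y s

/-- `2 μ' + 2 μ² F - c μ F` at the point `(x, y)`, with `c` the value of the ratio there. -/
def stretchExpr (f : V 2 → V 2 → ℝ) (c : ℝ) (x y : V 2) : ℝ :=
  2 * logDerivScalar' f x y + 2 * logDerivScalar f x y ^ 2 * f x y
    - c * logDerivScalar f x y * f x y

/-! ### Notions on the manifold -/

namespace FinslerMetric

variable {M : Type*} [TopologicalSpace M] [ChartedSpace (EuclideanSpace ℝ (Fin n)) M]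
  [IsManifold (𝓡 n) ∞ M]

/-- The expression of the Finsler metric in the local coordinates given by the chart `φ`:
`(x, y) ↦ F(φ⁻¹(x), d(φ⁻¹)_x y)`. -/
def inChart (F : FinslerMetric n M) (φ : OpenPartialHomeomorph M (EuclideanSpace ℝ (Fin n))) :
    V n → V n → ℝ := fun x y =>
  F.toFun ⟨φ.symm x, mfderiv (𝓡 n) (𝓡 n) φ.symm x y⟩

/-- `F` is Riemannian: `F(x, y) = √(a_x(y, y))` for a smooth Riemannian metric `a` on `M`. -/
def IsRiemannian (F : FinslerMetric n M) : Prop :=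
  ∃ a : Bundle.ContMDiffRiemannianMetric (𝓡 n) ∞ (EuclideanSpace ℝ (Fin n))
      (fun x : M => TangentSpace (𝓡 n) x),
    ∀ (x : M) (y : TangentSpace (𝓡 n) x), F.toFun ⟨x, y⟩ = √(a.inner x y y)

/-- `F` has relatively isotropic stretch curvature `c`, for a function `c` on `M`: in all local
coordinates, `Σ_ijkl = c F (C_{ijk|l} - C_{ijl|k})` on the slit tangent bundle. -/
def HasRelativelyIsotropicStretch (F : FinslerMetric n M) (c : M → ℝ) : Prop :=
  ∀ φ ∈ IsManifold.maximalAtlas (𝓡 n) ∞ M, ∀ x ∈ φ.target, ∀ y : V n, y ≠ 0 →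
    ∀ i j k l : Fin n,
      stretch (F.inChart φ) i j k l x y =
        c (φ.symm x) * F.inChart φ x y *
          (covDeriv (F.inChart φ) (cartan (F.inChart φ)) i j k l x y
            - covDeriv (F.inChart φ) (cartan (F.inChart φ)) i j l k x y)

end FinslerMetric

end Finsler

end

/-!
Let `'` be the derivative along the geodesic spray, i.e. in the direction `(y, -2G)` of the space
of pairs `(x, y)`; for functions it is `h ↦ h_{|s} yˢ` (`IsLocalMetric.hasDirDeriv_sprayDeriv`).
Along the spray the Berwald connection behaves like a metric connection: `F' = 0`, and
differentiating the equation that defines the spray with respect to `yʲ` and symmetrizing gives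
`g_{ij|s} yˢ = 0` (`IsLocalMetric.hasDirDeriv_fundamentalTensor`). Hence the covector `ℓ_i`, the
density `√(det g)` and the frame vector `m` are parallel along the spray, and for every tensor `T`
the scalar `F T(m, m, m)` has derivative `F T'(m, m, m)`
(`IsLocalMetric.hasDirDeriv_frameComponent`). Taking `T` to be the Cartan torsion and the Landsberg
curvature gives `I' = F L(m, m, m)` and `I'' = F L'(m, m, m)`.

Both the Cartan torsion and the Landsberg curvature are annihilated by `y`, and so are their
covariant derivatives in the tensor slots. Contracting the stretch equation with `yˡ` therefore
leaves `2 L' = c F L` (`IsLocalMetric.sprayCovDeriv_landsberg`), that is `2 I'' = c F I'`. Since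
`I' = μ F I` and `F' = 0`, this is the identity `2μ' + 2μ²F - cμF = 0` wherever `I ≠ 0`
(`IsLocalMetric.stretchExpr_eq_zero`).

So the nonvanishing condition says exactly that `I` vanishes identically. In dimension two this
makes the Cartan torsion vanish, so that `g_ij` does not depend on `y` (the punctured plane is
connected) and `F² = g_ij(x) yⁱ yʲ` (`IsLocalMetric.exists_quadratic`); polarization turns this into
a smooth Riemannian metric (`FinslerMetric.isRiemannian_of_bilinear`). Conversely, if `F²` is
quadratic on the fibres then `I = 0` (`principalScalar_eq_zero_of_quadratic`).
-/

noncomputable section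

namespace Finsler

variable {n : ℕ}

/-! ### Calculus of functions of position and velocity -/

/-- Smoothness of `h x y` as a function of the pair `(x, y) ∈ W`. -/
def SmoothOn (W : Set (V n × V n)) (h : V n → V n → ℝ) : Prop :=
  ContDiffOn ℝ ∞ (Function.uncurry h) W

/-- Positive homogeneity of degree `k` in the velocity, required at every base point. -/
def Homogeneous (k : ℕ) (h : V n → V n → ℝ) : Prop :=
  ∀ (x y : V n) (r : ℝ), 0 < r → h x (r • y) = r ^ k * h x y

theorem uncurry_hasFDerivAt {W : Set (V n × V n)} (hW : IsOpen W) {h : V n → V n → ℝ}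
    (hh : SmoothOn W h) {x y : V n} (hp : (x, y) ∈ W) :
    HasFDerivAt (Function.uncurry h) (fderiv ℝ (Function.uncurry h) (x, y)) (x, y) :=
  ((hh.contDiffAt (hW.mem_nhds hp)).differentiableAt (by simp)).hasFDerivAt

theorem dX_eq_fderiv {W : Set (V n × V n)} (hW : IsOpen W) {h : V n → V n → ℝ}
    (hh : SmoothOn W h) {x y : V n} (hp : (x, y) ∈ W) (i : Fin n) :
    dX i h x y = fderiv ℝ (Function.uncurry h) (x, y) (EuclideanSpace.single i 1, 0) := by
  have h1 : HasFDerivAt (fun z : V n => (z, y)) (ContinuousLinearMap.inl ℝ (V n) (V n)) x :=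
    hasFDerivAt_prodMk_left x y
  have h2 := (uncurry_hasFDerivAt hW hh hp).comp x h1
  have h3 : fderiv ℝ (fun z => h z y) x = _ := h2.fderiv
  rw [dX, h3]; simp

theorem dY_eq_fderiv {W : Set (V n × V n)} (hW : IsOpen W) {h : V n → V n → ℝ}
    (hh : SmoothOn W h) {x y : V n} (hp : (x, y) ∈ W) (i : Fin n) :
    dY i h x y = fderiv ℝ (Function.uncurry h) (x, y) (0, EuclideanSpace.single i 1) := by
  have h1 : HasFDerivAt (fun z : V n => (x, z)) (ContinuousLinearMap.inr ℝ (V n) (V n)) y :=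
    hasFDerivAt_prodMk_right x y
  have h2 := (uncurry_hasFDerivAt hW hh hp).comp y h1
  have h3 : fderiv ℝ (fun z => h x z) y = _ := h2.fderiv
  rw [dY, h3]; simp

theorem contDiffOn_fderiv_apply {W : Set (V n × V n)} (hW : IsOpen W) {h : V n → V n → ℝ}
    (hh : SmoothOn W h) (v : V n × V n) :
    ContDiffOn ℝ ∞ (fun p => fderiv ℝ (Function.uncurry h) p v) W :=
  (hh.fderiv_of_isOpen hW (by simp)).clm_apply contDiffOn_const

protected theorem SmoothOn.dX {W : Set (V n × V n)} {h : V n → V n → ℝ}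
    (hh : SmoothOn W h) (hW : IsOpen W) (i : Fin n) : SmoothOn W (dX i h) :=
  (contDiffOn_fderiv_apply hW hh (EuclideanSpace.single i 1, 0)).congr
    fun _ hp => dX_eq_fderiv hW hh hp i

protected theorem SmoothOn.dY {W : Set (V n × V n)} {h : V n → V n → ℝ}
    (hh : SmoothOn W h) (hW : IsOpen W) (i : Fin n) : SmoothOn W (dY i h) :=
  (contDiffOn_fderiv_apply hW hh (0, EuclideanSpace.single i 1)).congr
    fun _ hp => dY_eq_fderiv hW hh hp i

theorem fderiv_fderiv_comm {W : Set (V n × V n)} (hW : IsOpen W) {h : V n → V n → ℝ}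
    (hh : SmoothOn W h) {p : V n × V n} (hp : p ∈ W) (u v : V n × V n) :
    fderiv ℝ (fun q => fderiv ℝ (Function.uncurry h) q v) p u =
      fderiv ℝ (fun q => fderiv ℝ (Function.uncurry h) q u) p v := by
  have hc := hh.contDiffAt (hW.mem_nhds hp)
  have hd : DifferentiableAt ℝ (fderiv ℝ (Function.uncurry h)) p :=
    ((hh.fderiv_of_isOpen hW (m := ∞) (by simp)).contDiffAt (hW.mem_nhds hp)).differentiableAt
      (by simp)
  rw [fderiv_clm_apply hd (by fun_prop), fderiv_clm_apply hd (by fun_prop)]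
  simpa using (hc.isSymmSndFDerivAt
    (by simpa using WithTop.coe_le_coe.2 (le_top : (2 : ℕ∞) ≤ ⊤))) u v

theorem fderiv_congr_of_eqOn {W : Set (V n × V n)} (hW : IsOpen W)
    {a b : V n × V n → ℝ} (hab : ∀ q ∈ W, a q = b q) {p : V n × V n} (hp : p ∈ W) :
    fderiv ℝ a p = fderiv ℝ b p :=
  Filter.EventuallyEq.fderiv_eq (Filter.eventuallyEq_of_mem (hW.mem_nhds hp) hab)

theorem dY_comm {W : Set (V n × V n)} (hW : IsOpen W) {h : V n → V n → ℝ}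
    (hh : SmoothOn W h) {x y : V n} (hp : (x, y) ∈ W) (i j : Fin n) :
    dY i (dY j h) x y = dY j (dY i h) x y := by
  rw [dY_eq_fderiv hW (hh.dY hW j) hp, dY_eq_fderiv hW (hh.dY hW i) hp,
    fderiv_congr_of_eqOn (a := Function.uncurry (dY j h)) hW
      (fun _ hq => dY_eq_fderiv hW hh hq j) hp,
    fderiv_congr_of_eqOn (a := Function.uncurry (dY i h)) hW
      (fun _ hq => dY_eq_fderiv hW hh hq i) hp,
    fderiv_fderiv_comm hW hh hp]

theorem dX_dY_comm {W : Set (V n × V n)} (hW : IsOpen W) {h : V n → V n → ℝ}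
    (hh : SmoothOn W h) {x y : V n} (hp : (x, y) ∈ W) (i j : Fin n) :
    dX i (dY j h) x y = dY j (dX i h) x y := by
  rw [dX_eq_fderiv hW (hh.dY hW j) hp, dY_eq_fderiv hW (hh.dX hW i) hp,
    fderiv_congr_of_eqOn (a := Function.uncurry (dY j h)) hW
      (fun _ hq => dY_eq_fderiv hW hh hq j) hp,
    fderiv_congr_of_eqOn (a := Function.uncurry (dX i h)) hW
      (fun _ hq => dX_eq_fderiv hW hh hq i) hp,
    fderiv_fderiv_comm hW hh hp]

/-- `HasDirDeriv h x y v w a` says that `h` has derivative `a` at `(x, y)` along the line in the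
direction `(v, w)`. All the operators of the local calculus are of this form: `dX`, `dY`, `horiz`
and the derivative along the spray. -/
def HasDirDeriv (h : V n → V n → ℝ) (x y v w : V n) (a : ℝ) : Prop :=
  HasDerivAt (fun t : ℝ => h (x + t • v) (y + t • w)) a 0

/-- The chain rule in coordinates. -/
theorem SmoothOn.hasDirDeriv {W : Set (V n × V n)} {h : V n → V n → ℝ} (hh : SmoothOn W h)
    (hW : IsOpen W) {x y : V n} (hp : (x, y) ∈ W) (v w : V n) :
    HasDirDeriv h x y v w (∑ i, v i * dX i h x y + ∑ i, w i * dY i h x y) := by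
  have hl : HasDerivAt (fun t : ℝ => (x + t • v, y + t • w)) (v, w) 0 := by
    refine HasDerivAt.prodMk ?_ ?_
    · simpa using ((hasDerivAt_id (0 : ℝ)).smul_const v).const_add x
    · simpa using ((hasDerivAt_id (0 : ℝ)).smul_const w).const_add y
  have h0 : HasFDerivAt (Function.uncurry h) (fderiv ℝ (Function.uncurry h) (x, y))
      (x + (0 : ℝ) • v, y + (0 : ℝ) • w) := by
    simpa using uncurry_hasFDerivAt hW hh hp
  have h1 := h0.comp_hasDerivAt (0 : ℝ) hl
  have hv : (v, w) = ∑ i, v i • ((EuclideanSpace.single i 1, 0) : V n × V n)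
      + ∑ i, w i • ((0, EuclideanSpace.single i 1) : V n × V n) := by
    have e : ∀ u : V n, u = ∑ i, u i • (EuclideanSpace.single i (1 : ℝ) : V n) := fun u => by
      have := (EuclideanSpace.basisFun (Fin n) ℝ).sum_repr u
      simpa using this.symm
    refine Prod.ext ?_ ?_
    · simpa [Prod.fst_sum, Prod.snd_sum] using e v
    · simpa [Prod.fst_sum, Prod.snd_sum] using e w
  have h2 : fderiv ℝ (Function.uncurry h) (x, y) (v, w) =
      ∑ i, v i * dX i h x y + ∑ i, w i * dY i h x y := by
    rw [hv]
    simp only [map_add, map_sum, map_smul, smul_eq_mul, dX_eq_fderiv hW hh hp,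
      dY_eq_fderiv hW hh hp]
  rw [h2] at h1
  exact h1

theorem SmoothOn.hasDirDeriv_dX {W : Set (V n × V n)} {h : V n → V n → ℝ} (hh : SmoothOn W h)
    (hW : IsOpen W) {x y : V n} (hp : (x, y) ∈ W) (i : Fin n) :
    HasDirDeriv h x y (EuclideanSpace.single i 1) 0 (dX i h x y) := by
  simpa [Pi.single_apply] using hh.hasDirDeriv hW hp (EuclideanSpace.single i 1) 0

theorem SmoothOn.hasDirDeriv_dY {W : Set (V n × V n)} {h : V n → V n → ℝ} (hh : SmoothOn W h)
    (hW : IsOpen W) {x y : V n} (hp : (x, y) ∈ W) (i : Fin n) :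
    HasDirDeriv h x y 0 (EuclideanSpace.single i 1) (dY i h x y) := by
  simpa [Pi.single_apply] using hh.hasDirDeriv hW hp 0 (EuclideanSpace.single i 1)

/-- Functions that agree on an open set have the same directional derivatives there. -/
theorem HasDirDeriv.eq_of_eqOn {W : Set (V n × V n)} (hW : IsOpen W) {h k : V n → V n → ℝ}
    (hk : ∀ x y, (x, y) ∈ W → h x y = k x y) {x y v w : V n} (hp : (x, y) ∈ W) {a b : ℝ}
    (ha : HasDirDeriv h x y v w a) (hb : HasDirDeriv k x y v w b) : a = b := by
  refine HasDerivAt.unique ha (HasDerivAt.congr_of_eventuallyEq hb ?_)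
  have hc : Continuous fun t : ℝ => (x + t • v, y + t • w) := by fun_prop
  have := hc.continuousAt.preimage_mem_nhds (x := (0 : ℝ)) (t := W) (by
    simpa using hW.mem_nhds hp)
  filter_upwards [this] with t ht using hk _ _ ht

theorem HasDirDeriv.mul {h k : V n → V n → ℝ} {x y v w : V n} {a b : ℝ}
    (ha : HasDirDeriv h x y v w a) (hb : HasDirDeriv k x y v w b) :
    HasDirDeriv (fun x y => h x y * k x y) x y v w (a * k x y + h x y * b) := by
  simpa [HasDirDeriv] using HasDerivAt.fun_mul ha hb

theorem HasDirDeriv.sub {h k : V n → V n → ℝ} {x y v w : V n} {a b : ℝ}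
    (ha : HasDirDeriv h x y v w a) (hb : HasDirDeriv k x y v w b) :
    HasDirDeriv (fun x y => h x y - k x y) x y v w (a - b) :=
  HasDerivAt.fun_sub ha hb

theorem HasDirDeriv.neg {h : V n → V n → ℝ} {x y v w : V n} {a : ℝ}
    (ha : HasDirDeriv h x y v w a) :
    HasDirDeriv (fun x y => -h x y) x y v w (-a) :=
  HasDerivAt.fun_neg ha

theorem HasDirDeriv.div {h k : V n → V n → ℝ} {x y v w : V n} {a b : ℝ}
    (ha : HasDirDeriv h x y v w a) (hb : HasDirDeriv k x y v w b) (hk : k x y ≠ 0) :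
    HasDirDeriv (fun x y => h x y / k x y) x y v w ((a * k x y - h x y * b) / k x y ^ 2) := by
  simpa [HasDirDeriv] using HasDerivAt.fun_div ha hb (by simpa using hk)

theorem HasDirDeriv.sqrt {h : V n → V n → ℝ} {x y v w : V n} {a : ℝ}
    (ha : HasDirDeriv h x y v w a) (hk : h x y ≠ 0) :
    HasDirDeriv (fun x y => √(h x y)) x y v w (a / (2 * √(h x y))) := by
  simpa [HasDirDeriv] using HasDerivAt.sqrt ha (by simpa using hk)

theorem HasDirDeriv.sum {ι : Type*} (s : Finset ι) {h : ι → V n → V n → ℝ} {x y v w : V n}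
    {a : ι → ℝ} (ha : ∀ i ∈ s, HasDirDeriv (h i) x y v w (a i)) :
    HasDirDeriv (fun x y => ∑ i ∈ s, h i x y) x y v w (∑ i ∈ s, a i) :=
  HasDerivAt.fun_sum ha

theorem hasDirDeriv_const (x y v w : V n) (c : ℝ) : HasDirDeriv (fun _ _ => c) x y v w 0 :=
  hasDerivAt_const _ _

theorem hasDirDeriv_velocity (x y v w : V n) (i : Fin n) :
    HasDirDeriv (fun _ y => y i) x y v w (w i) := by
  have := ((hasDerivAt_id (0 : ℝ)).mul_const (w i)).const_add (y i)
  simpa [HasDirDeriv] using this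

/-! ### Homogeneity -/

protected theorem Homogeneous.dY {k : ℕ} {h : V n → V n → ℝ} (hh : Homogeneous (k + 1) h)
    (i : Fin n) :
    Homogeneous k (dY i h) := by
  intro x y r hr
  have h1 : fderiv ℝ (fun z => h x (r • z)) y = r • fderiv ℝ (fun z => h x z) (r • y) := by
    have := fderiv_comp_smul (𝕜 := ℝ) (f := fun z => h x z) (x := y) r
    simpa using this
  have h2 : fderiv ℝ (fun z => h x (r • z)) y = r ^ (k + 1) • fderiv ℝ (fun z => h x z) y := by
    have : (fun z => h x (r • z)) = r ^ (k + 1) • fun z => h x z := by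
      funext z; simp [hh x z r hr]
    rw [this, fderiv_const_smul_field, Pi.smul_apply]
  have h3 := congrArg (fun L => L (EuclideanSpace.single i 1)) (h1.symm.trans h2)
  simp only [smul_apply, smul_eq_mul] at h3
  have h4 : r * (Finsler.dY i h x (r • y)) = r * (r ^ k * Finsler.dY i h x y) := by
    simp only [Finsler.dY]; rw [h3]; ring
  exact mul_left_cancel₀ hr.ne' h4

protected theorem Homogeneous.dX {k : ℕ} {h : V n → V n → ℝ} (hh : Homogeneous k h) (i : Fin n) :
    Homogeneous k (dX i h) := by
  intro x y r hr
  have : (fun z => h z (r • y)) = r ^ k • fun z => h z y := by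
    funext z; simp [hh z y r hr]
  simp only [Finsler.dX]
  rw [this, fderiv_const_smul_field]
  simp

/-- Euler's theorem on homogeneous functions. -/
protected theorem Homogeneous.euler {k : ℕ} {h : V n → V n → ℝ} (hk : Homogeneous k h)
    {W : Set (V n × V n)} (hW : IsOpen W) (hh : SmoothOn W h) {x y : V n} (hp : (x, y) ∈ W) :
    ∑ i, y i * Finsler.dY i h x y = k * h x y := by
  have h1 := hh.hasDirDeriv hW hp 0 y
  have h2 : HasDerivAt (fun t : ℝ => (1 + t) ^ k * h x y) (k * h x y) 0 := by
    simpa using (((hasDerivAt_id (0 : ℝ)).const_add 1).fun_pow k).mul_const (h x y)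
  have h3 : HasDirDeriv h x y 0 y (k * h x y) := by
    refine HasDerivAt.congr_of_eventuallyEq h2 ?_
    filter_upwards [Ioi_mem_nhds (show (-1 : ℝ) < 0 by norm_num)] with t ht
    have : y + t • y = (1 + t) • y := by rw [add_smul, one_smul]
    simp only [smul_zero, add_zero, this]
    exact hk x y _ (by have := Set.mem_Ioi.1 ht; linarith)
  simpa using HasDerivAt.unique h1 h3

/-! ### Finsler metrics on open subsets of the plane -/

section Smoothness

variable {n : ℕ} {W : Set (V n × V n)} {h k : V n → V n → ℝ}

theorem SmoothOn.sub (hh : SmoothOn W h) (hk : SmoothOn W k) :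
    SmoothOn W (fun x y => h x y - k x y) := ContDiffOn.sub hh hk

theorem SmoothOn.neg (hh : SmoothOn W h) :
    SmoothOn W (fun x y => -h x y) := ContDiffOn.neg hh

theorem SmoothOn.mul (hh : SmoothOn W h) (hk : SmoothOn W k) :
    SmoothOn W (fun x y => h x y * k x y) := ContDiffOn.mul hh hk

theorem SmoothOn.div (hh : SmoothOn W h) (hk : SmoothOn W k)
    (h0 : ∀ x y, (x, y) ∈ W → k x y ≠ 0) :
    SmoothOn W (fun x y => h x y / k x y) := ContDiffOn.div hh hk fun p hp => h0 p.1 p.2 hp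

theorem SmoothOn.sqrt (hh : SmoothOn W h) (h0 : ∀ x y, (x, y) ∈ W → h x y ≠ 0) :
    SmoothOn W (fun x y => √(h x y)) := ContDiffOn.sqrt hh fun p hp => h0 p.1 p.2 hp

theorem SmoothOn.sum {ι : Type*} (s : Finset ι) {h : ι → V n → V n → ℝ}
    (hh : ∀ i ∈ s, SmoothOn W (h i)) : SmoothOn W (fun x y => ∑ i ∈ s, h i x y) :=
  ContDiffOn.sum hh

theorem smoothOn_const (c : ℝ) : SmoothOn W (fun _ _ => c) := contDiffOn_const

theorem smoothOn_velocity (i : Fin n) : SmoothOn W (fun _ y => y i) := by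
  have : ContDiff ℝ ∞ (fun p : V n × V n => p.2 i) := by fun_prop
  exact this.contDiffOn

theorem SmoothOn.mono {W' : Set (V n × V n)} (hh : SmoothOn W h) (hW : W' ⊆ W) :
    SmoothOn W' h := ContDiffOn.mono hh hW

theorem SmoothOn.congr (hh : SmoothOn W h) (hk : ∀ x y, (x, y) ∈ W → k x y = h x y) :
    SmoothOn W k := ContDiffOn.congr hh fun p hp => hk p.1 p.2 hp

end Smoothness

/-- `f` is the coordinate expression of a Finsler metric over the open set `U` of the plane. Of
positive definiteness only the consequences `F > 0` and `det g > 0` are recorded. Homogeneity is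
required at every base point, also outside `U`, as it costs nothing for the expression in a chart
and spares a restriction when homogeneous functions are differentiated in `x`. -/
structure IsLocalMetric (f : V 2 → V 2 → ℝ) (U : Set (V 2)) : Prop where
  isOpen : IsOpen U
  smooth : SmoothOn (U ×ˢ {0}ᶜ) f
  homogeneous : Homogeneous 1 f
  pos : ∀ x ∈ U, ∀ y : V 2, y ≠ 0 → 0 < f x y
  det_pos : ∀ x ∈ U, ∀ y : V 2, y ≠ 0 → 0 < (gMatrix f x y).det

/-- The function `F²`. -/
def energy (f : V 2 → V 2 → ℝ) : V 2 → V 2 → ℝ := fun x y => f x y ^ 2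

/-- The velocity component `-2G` of the geodesic spray at `(x, y)`. -/
def sprayVelocity (f : V 2 → V 2 → ℝ) (x y : V 2) : V 2 :=
  WithLp.toLp 2 fun i => -2 * spray f i x y

/-- The derivative `h_{|s} yˢ` of a function along the geodesic spray. -/
def sprayDeriv (f h : V 2 → V 2 → ℝ) : V 2 → V 2 → ℝ := fun x y =>
  ∑ s, horiz f s h x y * y s

/-- The covariant derivative `T_{ijk|s} yˢ` of a tensor along the geodesic spray. -/
def sprayCovDeriv (f : V 2 → V 2 → ℝ) (T : Fin 2 → Fin 2 → Fin 2 → V 2 → V 2 → ℝ)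
    (i j k : Fin 2) : V 2 → V 2 → ℝ := fun x y =>
  ∑ s, covDeriv f T i j k s x y * y s

/-- The scalar `F T_ijk mⁱ mʲ mᵏ`. -/
def frameComponent (f : V 2 → V 2 → ℝ) (T : Fin 2 → Fin 2 → Fin 2 → V 2 → V 2 → ℝ) :
    V 2 → V 2 → ℝ := fun x y =>
  f x y * ∑ i, ∑ j, ∑ k, T i j k x y *
    berwaldM f x y i * berwaldM f x y j * berwaldM f x y k

theorem gMatrix_det (f : V 2 → V 2 → ℝ) (x y : V 2) : (gMatrix f x y).det =
    fundamentalTensor f 0 0 x y * fundamentalTensor f 1 1 x y -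
      fundamentalTensor f 0 1 x y * fundamentalTensor f 1 0 x y := by
  simp [Matrix.det_fin_two, gMatrix]

/-- `h_{|k}` is the derivative in the direction `(e_k, -N_k)`. -/
theorem SmoothOn.hasDirDeriv_horiz (f : V 2 → V 2 → ℝ) {W : Set (V 2 × V 2)} (hW : IsOpen W)
    {h : V 2 → V 2 → ℝ} (hh : SmoothOn W h) {x y : V 2} (hp : (x, y) ∈ W) (k : Fin 2) :
    HasDirDeriv h x y (EuclideanSpace.single k 1)
      (WithLp.toLp 2 fun m => -nonlinConn f m k x y) (horiz f k h x y) := by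
  have := hh.hasDirDeriv hW hp (EuclideanSpace.single k 1)
    (WithLp.toLp 2 fun m => -nonlinConn f m k x y)
  simpa [horiz, Pi.single_apply, sub_eq_add_neg, Finset.sum_neg_distrib] using this

namespace IsLocalMetric

variable {f : V 2 → V 2 → ℝ} {U : Set (V 2)}

theorem isOpen_slit (hf : IsLocalMetric f U) : IsOpen (U ×ˢ ({0}ᶜ : Set (V 2))) :=
  hf.isOpen.prod isOpen_compl_singleton

theorem smooth_energy (hf : IsLocalMetric f U) : SmoothOn (U ×ˢ {0}ᶜ) (energy f) :=
  ContDiffOn.pow hf.smooth 2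

theorem homogeneous_energy (hf : IsLocalMetric f U) : Homogeneous 2 (energy f) := by
  intro x y r hr
  simp only [energy, hf.homogeneous x y r hr]; ring

theorem smooth_fundamentalTensor (hf : IsLocalMetric f U) (i j : Fin 2) :
    SmoothOn (U ×ˢ {0}ᶜ) (fundamentalTensor f i j) :=
  (smoothOn_const _).mul ((hf.smooth_energy.dY hf.isOpen_slit j).dY hf.isOpen_slit i)

theorem homogeneous_fundamentalTensor (hf : IsLocalMetric f U) (i j : Fin 2) :
    Homogeneous 0 (fundamentalTensor f i j) := by
  intro x y r hr
  have := ((hf.homogeneous_energy.dY j).dY i) x y r hr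
  simp only [pow_zero, one_mul] at this ⊢
  exact congrArg (fun a => (1 / 2 : ℝ) * a) this

theorem fundamentalTensor_symm (hf : IsLocalMetric f U) {x y : V 2} (hp : (x, y) ∈ U ×ˢ {0}ᶜ)
    (i j : Fin 2) : fundamentalTensor f i j x y = fundamentalTensor f j i x y :=
  congrArg (fun a => (1 / 2 : ℝ) * a) (dY_comm hf.isOpen_slit hf.smooth_energy hp i j)

theorem smooth_det (hf : IsLocalMetric f U) :
    SmoothOn (U ×ˢ {0}ᶜ) (fun x y => (gMatrix f x y).det) := by
  simp only [gMatrix_det]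
  exact ((hf.smooth_fundamentalTensor 0 0).mul (hf.smooth_fundamentalTensor 1 1)).sub
    ((hf.smooth_fundamentalTensor 0 1).mul (hf.smooth_fundamentalTensor 1 0))

theorem det_pos_of_mem (hf : IsLocalMetric f U) {x y : V 2} (hp : (x, y) ∈ U ×ˢ {0}ᶜ) :
    0 < (gMatrix f x y).det := hf.det_pos x hp.1 y hp.2

theorem pos_of_mem (hf : IsLocalMetric f U) {x y : V 2} (hp : (x, y) ∈ U ×ˢ {0}ᶜ) :
    0 < f x y := hf.pos x hp.1 y hp.2

theorem smooth_inv (hf : IsLocalMetric f U) (i j : Fin 2) :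
    SmoothOn (U ×ˢ {0}ᶜ) (fun x y => (gMatrix f x y)⁻¹ i j) := by
  have hadj : SmoothOn (U ×ˢ {0}ᶜ) (fun x y => (gMatrix f x y).adjugate i j) := by
    simp only [Matrix.adjugate_fin_two]
    fin_cases i <;> fin_cases j
    · exact hf.smooth_fundamentalTensor 1 1
    · exact (hf.smooth_fundamentalTensor 0 1).neg
    · exact (hf.smooth_fundamentalTensor 1 0).neg
    · exact hf.smooth_fundamentalTensor 0 0
  refine (hadj.div hf.smooth_det fun x y hp => (hf.det_pos_of_mem hp).ne').congr fun x y _ => ?_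
  simp only [Matrix.inv_def, Ring.inverse_eq_inv', Matrix.smul_apply, smul_eq_mul]
  ring

theorem smooth_spray (hf : IsLocalMetric f U) (i : Fin 2) :
    SmoothOn (U ×ˢ {0}ᶜ) (spray f i) := by
  have hW := hf.isOpen_slit
  have hQ := hf.smooth_energy
  refine (smoothOn_const _).mul (SmoothOn.sum _ fun l _ => (hf.smooth_inv i l).mul
    (SmoothOn.sub (SmoothOn.sum _ fun k _ => ?_) (hQ.dX hW l)))
  exact ((hQ.dY hW l).dX hW k).mul (smoothOn_velocity k)

theorem homogeneous_spray (hf : IsLocalMetric f U) (i : Fin 2) : Homogeneous 2 (spray f i) := by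
  intro x y r hr
  have hg : gMatrix f x (r • y) = gMatrix f x y := by
    ext a b
    simpa [gMatrix] using hf.homogeneous_fundamentalTensor a b x y r hr
  have h1 : ∀ l k, dX k (dY l (energy f)) x (r • y) = r * dX k (dY l (energy f)) x y := fun l k =>
    by simpa using ((hf.homogeneous_energy.dY l).dX k) x y r hr
  have h2 : ∀ l, dX l (energy f) x (r • y) = r ^ 2 * dX l (energy f) x y := fun l =>
    (hf.homogeneous_energy.dX l) x y r hr
  unfold energy at h1 h2
  simp only [spray, hg, h1, h2, Fin.sum_univ_two, PiLp.smul_apply, smul_eq_mul]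
  ring

theorem smooth_nonlinConn (hf : IsLocalMetric f U) (i j : Fin 2) :
    SmoothOn (U ×ˢ {0}ᶜ) (nonlinConn f i j) := (hf.smooth_spray i).dY hf.isOpen_slit j

theorem smooth_berwaldConn (hf : IsLocalMetric f U) (i j k : Fin 2) :
    SmoothOn (U ×ˢ {0}ᶜ) (berwaldConn f i j k) :=
  ((hf.smooth_spray i).dY hf.isOpen_slit k).dY hf.isOpen_slit j

/-- `Nⁱ_j yʲ = 2 Gⁱ`. -/
theorem nonlinConn_velocity (hf : IsLocalMetric f U) {x y : V 2} (hp : (x, y) ∈ U ×ˢ {0}ᶜ)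
    (i : Fin 2) : ∑ j, y j * nonlinConn f i j x y = 2 * spray f i x y := by
  simpa [nonlinConn] using (hf.homogeneous_spray i).euler hf.isOpen_slit (hf.smooth_spray i) hp

/-- `Γⁱ_jk yʲ = Nⁱ_k`. -/
theorem berwaldConn_velocity (hf : IsLocalMetric f U) {x y : V 2} (hp : (x, y) ∈ U ×ˢ {0}ᶜ)
    (i k : Fin 2) : ∑ j, y j * berwaldConn f i j k x y = nonlinConn f i k x y := by
  simpa [nonlinConn, berwaldConn] using ((hf.homogeneous_spray i).dY k).euler
    hf.isOpen_slit (hf.smooth_nonlinConn i k) hp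

theorem berwaldConn_symm (hf : IsLocalMetric f U) {x y : V 2} (hp : (x, y) ∈ U ×ˢ {0}ᶜ)
    (i j k : Fin 2) : berwaldConn f i j k x y = berwaldConn f i k j x y :=
  dY_comm hf.isOpen_slit (hf.smooth_spray i) hp j k

theorem smooth_horiz (hf : IsLocalMetric f U)
    {h : V 2 → V 2 → ℝ} (hh : SmoothOn (U ×ˢ {0}ᶜ) h) (k : Fin 2) :
    SmoothOn (U ×ˢ {0}ᶜ) (horiz f k h) :=
  (hh.dX hf.isOpen_slit k).sub (SmoothOn.sum _ fun m _ =>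
    (hf.smooth_nonlinConn m k).mul (hh.dY hf.isOpen_slit m))

/-- `h_{|s} yˢ` is the derivative of `h` in the direction of the geodesic spray, which is
`(y, -2G)`. -/
theorem hasDirDeriv_sprayDeriv (hf : IsLocalMetric f U) {W : Set (V 2 × V 2)} (hW : IsOpen W)
    (hWU : W ⊆ U ×ˢ {0}ᶜ)
    {h : V 2 → V 2 → ℝ} (hh : SmoothOn W h) {x y : V 2} (hp : (x, y) ∈ W) :
    HasDirDeriv h x y y (sprayVelocity f x y) (sprayDeriv f h x y) := by
  have := hh.hasDirDeriv hW hp y (sprayVelocity f x y)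
  have h0 := hf.nonlinConn_velocity (hWU hp) 0
  have h1 := hf.nonlinConn_velocity (hWU hp) 1
  convert this using 1
  simp only [sprayDeriv, horiz, sprayVelocity, Fin.sum_univ_two] at *
  linear_combination -dY 0 h x y * h0 - dY 1 h x y * h1

/-! ### The fundamental tensor and the frame along the spray -/

/-- The equation `4 g_lm Gᵐ = ∂²F²/∂xᵏ∂yˡ yᵏ - ∂F²/∂xˡ` defining the spray. -/
theorem spray_lower (hf : IsLocalMetric f U) {x y : V 2} (hp : (x, y) ∈ U ×ˢ {0}ᶜ) (l : Fin 2) :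
    ∑ m, 4 * (fundamentalTensor f l m x y * spray f m x y) =
      (∑ k, dX k (dY l (energy f)) x y * y k) - dX l (energy f) x y := by
  have h1 : gMatrix f x y * (gMatrix f x y)⁻¹ = 1 :=
    Matrix.mul_nonsing_inv _ (hf.det_pos_of_mem hp).ne'.isUnit
  let B : Fin 2 → ℝ := fun l =>
    (∑ k, dX k (dY l (energy f)) x y * y k) - dX l (energy f) x y
  have h2 : Matrix.mulVec (gMatrix f x y) (Matrix.mulVec (gMatrix f x y)⁻¹ B) = B := by
    rw [Matrix.mulVec_mulVec, h1, Matrix.one_mulVec]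
  have h3 : ∑ m, fundamentalTensor f l m x y * ∑ k, (gMatrix f x y)⁻¹ m k * B k = B l :=
    congrFun h2 l
  have h4 : ∀ m, spray f m x y = 1 / 4 * ∑ k, (gMatrix f x y)⁻¹ m k * B k := fun _ => rfl
  change _ = B l
  rw [← h3]
  refine Finset.sum_congr rfl fun m _ => ?_
  rw [h4]; ring

theorem dY_energy (hf : IsLocalMetric f U) {x y : V 2} (hp : (x, y) ∈ U ×ˢ {0}ᶜ) (i : Fin 2) :
    dY i (energy f) x y = ∑ j, 2 * (fundamentalTensor f i j x y * y j) := by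
  have h1 := (hf.homogeneous_energy.dY i).euler hf.isOpen_slit
    (hf.smooth_energy.dY hf.isOpen_slit i) hp
  have h2 : ∀ j, dY j (dY i (energy f)) x y = 2 * fundamentalTensor f i j x y := fun j => by
    rw [hf.fundamentalTensor_symm hp]
    change _ = 2 * (1 / 2 * dY j (dY i (energy f)) x y)
    ring
  simp only [h2, Fin.sum_univ_two] at *
  push_cast at h1
  linear_combination -h1

/-- `F² = g_ij yⁱ yʲ`. -/
theorem energy_eq (hf : IsLocalMetric f U) {x y : V 2} (hp : (x, y) ∈ U ×ˢ {0}ᶜ) :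
    f x y ^ 2 = ∑ i, ∑ j, fundamentalTensor f i j x y * y i * y j := by
  have h1 := hf.homogeneous_energy.euler hf.isOpen_slit hf.smooth_energy hp
  simp only [hf.dY_energy hp, Fin.sum_univ_two, energy] at *
  push_cast at h1
  linear_combination -h1 / 2

/-- `F` is constant along the geodesic flow. -/
theorem hasDirDeriv_self (hf : IsLocalMetric f U) {x y : V 2} (hp : (x, y) ∈ U ×ˢ {0}ᶜ) :
    HasDirDeriv f x y y (sprayVelocity f x y) 0 := by
  have hW := hf.isOpen_slit
  have h1 := hf.smooth.hasDirDeriv hW hp y (sprayVelocity f x y)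
  have hQ := hf.smooth_energy.hasDirDeriv hW hp y (sprayVelocity f x y)
  have hQ' : HasDirDeriv (energy f) x y y (sprayVelocity f x y)
      ((∑ i, y i * dX i f x y + ∑ i, sprayVelocity f x y i * dY i f x y) * f x y +
        f x y * (∑ i, y i * dX i f x y + ∑ i, sprayVelocity f x y i * dY i f x y)) := by
    have he : energy f = fun x y => f x y * f x y := by funext; simp [energy, pow_two]
    rw [he]; exact h1.mul h1
  have e1 := HasDerivAt.unique hQ hQ'
  have hx : ∀ k, ∑ l, y l * dX k (dY l (energy f)) x y = 2 * dX k (energy f) x y := fun k => by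
    have := (hf.homogeneous_energy.dX k).euler hW (hf.smooth_energy.dX hW k) hp
    simpa only [dX_dY_comm hW hf.smooth_energy hp, Nat.cast_ofNat] using this
  have hx0 := hx 0
  have hx1 := hx 1
  have s0 := hf.spray_lower hp 0
  have s1 := hf.spray_lower hp 1
  have hz : ∑ i, y i * dX i (energy f) x y + ∑ i, sprayVelocity f x y i * dY i (energy f) x y
      = 0 := by
    simp only [hf.dY_energy hp, sprayVelocity, Fin.sum_univ_two] at *
    have hs := hf.fundamentalTensor_symm hp 0 1
    linear_combination -y 0 * s0 - y 1 * s1 - y 0 * hx0 - y 1 * hx1 +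
      (-4 * spray f 0 x y * y 1 + 4 * spray f 1 x y * y 0) * hs
  rw [hz] at e1
  have h2 : (∑ i, y i * dX i f x y + ∑ i, sprayVelocity f x y i * dY i f x y) = 0 := by
    have := (hf.pos_of_mem hp).ne'
    have h3 : (∑ i, y i * dX i f x y + ∑ i, sprayVelocity f x y i * dY i f x y) * f x y = 0 := by
      linarith
    exact (mul_eq_zero.1 h3).resolve_right this
  rwa [h2] at h1

theorem dY_fundamentalTensor_symm (hf : IsLocalMetric f U) {x y : V 2}
    (hp : (x, y) ∈ U ×ˢ {0}ᶜ) (i j k : Fin 2) :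
    dY k (fundamentalTensor f i j) x y = dY k (fundamentalTensor f j i) x y :=
  HasDirDeriv.eq_of_eqOn hf.isOpen_slit (fun _ _ h => hf.fundamentalTensor_symm h i j) hp
    ((hf.smooth_fundamentalTensor i j).hasDirDeriv_dY hf.isOpen_slit hp k)
    ((hf.smooth_fundamentalTensor j i).hasDirDeriv_dY hf.isOpen_slit hp k)

/-- `∂g_ij/∂yᵏ` is half the third derivative of `F²`, hence invariant under cyclic permutations. -/
theorem dY_fundamentalTensor_cycle (hf : IsLocalMetric f U) {x y : V 2}
    (hp : (x, y) ∈ U ×ˢ {0}ᶜ) (i j k : Fin 2) :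
    dY k (fundamentalTensor f i j) x y = dY i (fundamentalTensor f j k) x y := by
  have hW := hf.isOpen_slit
  have hQ := hf.smooth_energy
  have e : ∀ p q r : Fin 2, dY r (fundamentalTensor f p q) x y =
      1 / 2 * dY r (dY p (dY q (energy f))) x y := by
    intro p q r
    have h1 := (hasDirDeriv_const x y 0 (EuclideanSpace.single r 1) (1 / 2)).mul
      (((hQ.dY hW q).dY hW p).hasDirDeriv_dY hW hp r)
    have h2 := HasDerivAt.unique ((hf.smooth_fundamentalTensor p q).hasDirDeriv_dY hW hp r) h1
    rw [h2]; ring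
  rw [e, dY_comm hW (hQ.dY hW j) hp, ← e, hf.dY_fundamentalTensor_symm hp]

/-- `g_{ij|s} yˢ = 0`: the fundamental tensor is parallel along the spray. It follows by
differentiating the equation of the spray with respect to `yʲ` and symmetrizing. -/
theorem hasDirDeriv_fundamentalTensor (hf : IsLocalMetric f U) {x y : V 2}
    (hp : (x, y) ∈ U ×ˢ {0}ᶜ) (i j : Fin 2) :
    HasDirDeriv (fundamentalTensor f i j) x y y (sprayVelocity f x y)
      (∑ m, (nonlinConn f m i x y * fundamentalTensor f m j x y +
        nonlinConn f m j x y * fundamentalTensor f i m x y)) := by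
  have hW := hf.isOpen_slit
  have hg := hf.smooth_fundamentalTensor
  have hQ := hf.smooth_energy
  -- the equation of the spray differentiated with respect to `yᵃ`
  have key : ∀ l a : Fin 2, ∑ m, 4 * (dY a (fundamentalTensor f l m) x y * spray f m x y
        + fundamentalTensor f l m x y * nonlinConn f m a x y) =
      (∑ k, dY a (dX k (dY l (energy f))) x y * y k) + dY l (dX a (energy f)) x y
        - dY a (dX l (energy f)) x y := by
    intro l a
    refine HasDirDeriv.eq_of_eqOn hW (fun x y h => hf.spray_lower h l) hp
      (v := 0) (w := EuclideanSpace.single a 1) ?_ ?_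
    · refine HasDirDeriv.sum _ fun m _ => ?_
      simpa [nonlinConn] using (hasDirDeriv_const x y _ _ 4).mul
        (((hg l m).hasDirDeriv_dY hW hp a).mul
        ((hf.smooth_spray m).hasDirDeriv_dY hW hp a))
    · have h1 := (HasDirDeriv.sum Finset.univ fun k _ =>
        (((hQ.dY hW l).dX hW k).hasDirDeriv_dY hW hp a).mul
          (hasDirDeriv_velocity x y 0 (EuclideanSpace.single a 1) k)).sub
            ((hQ.dX hW l).hasDirDeriv_dY hW hp a)
      convert h1 using 1
      simp [Finset.sum_add_distrib, dX_dY_comm hW hQ hp]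
  have hgX : ∀ a l k : Fin 2, dX k (fundamentalTensor f a l) x y =
      1 / 2 * dY a (dX k (dY l (energy f))) x y := by
    intro a l k
    have h1 := (hasDirDeriv_const x y (EuclideanSpace.single k 1) 0 (1 / 2)).mul
      (((hQ.dY hW l).dY hW a).hasDirDeriv_dX hW hp k)
    have h2 := HasDerivAt.unique ((hg a l).hasDirDeriv_dX hW hp k) h1
    rw [h2, dX_dY_comm hW (hQ.dY hW l) hp]
    ring
  have hgY := hf.dY_fundamentalTensor_cycle hp
  have e2 := hf.dY_fundamentalTensor_symm hp
  have hs : ∀ a b, fundamentalTensor f a b x y = fundamentalTensor f b a x y :=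
    hf.fundamentalTensor_symm hp
  have h0 := (hg i j).hasDirDeriv hW hp y (sprayVelocity f x y)
  convert h0 using 1
  have hij := key i j
  have hji := key j i
  have gij : ∀ k, dX k (fundamentalTensor f i j) x y = dX k (fundamentalTensor f j i) x y :=
    fun k => HasDirDeriv.eq_of_eqOn hW (fun x y h => hf.fundamentalTensor_symm h i j) hp
        ((hg i j).hasDirDeriv_dX hW hp k) ((hg j i).hasDirDeriv_dX hW hp k)
  have yij : ∀ m, dY j (fundamentalTensor f i m) x y = dY m (fundamentalTensor f i j) x y :=
    fun m => by rw [e2 i j m, hgY j i m]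
  have yji : ∀ m, dY i (fundamentalTensor f j m) x y = dY m (fundamentalTensor f i j) x y :=
    fun m => (hgY i j m).symm
  have xij : ∀ k, dY j (dX k (dY i (energy f))) x y =
      2 * dX k (fundamentalTensor f i j) x y := fun k => by rw [gij, hgX]; ring
  have xji : ∀ k, dY i (dX k (dY j (energy f))) x y =
      2 * dX k (fundamentalTensor f i j) x y := fun k => by rw [hgX]; ring
  simp only [yij, yji, xij, xji, hs j, hs i, sprayVelocity, Fin.sum_univ_two] at *
  linear_combination (hij + hji) / 4

theorem smooth_ellLower (hf : IsLocalMetric f U) (i : Fin 2) :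
    SmoothOn (U ×ˢ {0}ᶜ) (ellLower f i) :=
  SmoothOn.sum _ fun j _ => (hf.smooth_fundamentalTensor i j).mul
    ((smoothOn_velocity j).div hf.smooth fun _ _ hp => (hf.pos_of_mem hp).ne')

/-- `ℓ_{i|s} yˢ = 0`. -/
theorem hasDirDeriv_ellLower (hf : IsLocalMetric f U) {x y : V 2}
    (hp : (x, y) ∈ U ×ˢ {0}ᶜ) (i : Fin 2) :
    HasDirDeriv (ellLower f i) x y y (sprayVelocity f x y)
      (∑ m, nonlinConn f m i x y * ellLower f m x y) := by
  have hF := (hf.pos_of_mem hp).ne'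
  have h1 : HasDirDeriv (ellLower f i) x y y (sprayVelocity f x y) _ :=
    HasDirDeriv.sum Finset.univ fun j _ => (hf.hasDirDeriv_fundamentalTensor hp i j).mul
      ((hasDirDeriv_velocity x y y (sprayVelocity f x y) j).div (hf.hasDirDeriv_self hp) hF)
  convert h1 using 1
  have n0 := hf.nonlinConn_velocity hp 0
  have n1 := hf.nonlinConn_velocity hp 1
  simp only [Fin.sum_univ_two, sprayVelocity, ellLower] at *
  have e0 : spray f 0 x y = (y 0 * nonlinConn f 0 0 x y + y 1 * nonlinConn f 0 1 x y) / 2 := by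
    linarith
  have e1 : spray f 1 x y = (y 0 * nonlinConn f 1 0 x y + y 1 * nonlinConn f 1 1 x y) / 2 := by
    linarith
  rw [e0, e1]
  field_simp
  ring

/-- `(√(det g))_{|s} yˢ = 0`, `√(det g)` being a density of weight one. -/
theorem hasDirDeriv_sqrt_det (hf : IsLocalMetric f U) {x y : V 2} (hp : (x, y) ∈ U ×ˢ {0}ᶜ) :
    HasDirDeriv (fun x y => √((gMatrix f x y).det)) x y y (sprayVelocity f x y)
      ((∑ m, nonlinConn f m m x y) * √((gMatrix f x y).det)) := by
  have hd := hf.det_pos_of_mem hp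
  have hg := hf.hasDirDeriv_fundamentalTensor hp
  have h1 := ((hg 0 0).mul (hg 1 1)).sub ((hg 0 1).mul (hg 1 0))
  simp only [← gMatrix_det] at h1
  convert h1.sqrt hd.ne' using 1
  have hs : √((gMatrix f x y).det) ≠ 0 := (Real.sqrt_pos.2 hd).ne'
  have hsq := Real.sq_sqrt hd.le
  have s01 := hf.fundamentalTensor_symm hp 0 1
  rw [eq_div_iff (by positivity)]
  have e : ∀ t : ℝ, t * √((gMatrix f x y).det) * (2 * √((gMatrix f x y).det)) =
      2 * t * (gMatrix f x y).det := fun t => by linear_combination 2 * t * hsq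
  rw [e, gMatrix_det]
  simp only [Fin.sum_univ_two]
  rw [s01]
  ring

theorem smooth_berwaldM (hf : IsLocalMetric f U) (i : Fin 2) :
    SmoothOn (U ×ˢ {0}ᶜ) (fun x y => berwaldM f x y i) := by
  have hs := hf.smooth_det.sqrt fun x y hp => (hf.det_pos_of_mem hp).ne'
  have h0 : ∀ x y, (x, y) ∈ U ×ˢ {0}ᶜ → √((gMatrix f x y).det) ≠ 0 := fun x y hp =>
    (Real.sqrt_pos.2 (hf.det_pos_of_mem hp)).ne'
  fin_cases i
  · exact (hf.smooth_ellLower 1).neg.div hs h0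
  · exact (hf.smooth_ellLower 0).div hs h0

/-- `mⁱ_{|s} yˢ = 0`. -/
theorem hasDirDeriv_berwaldM (hf : IsLocalMetric f U) {x y : V 2} (hp : (x, y) ∈ U ×ˢ {0}ᶜ)
    (i : Fin 2) :
    HasDirDeriv (fun x y => berwaldM f x y i) x y y (sprayVelocity f x y)
      (-∑ j, nonlinConn f i j x y * berwaldM f x y j) := by
  have hs : √((gMatrix f x y).det) ≠ 0 := (Real.sqrt_pos.2 (hf.det_pos_of_mem hp)).ne'
  have hd := hf.hasDirDeriv_sqrt_det hp
  have h0 := (hf.hasDirDeriv_ellLower hp 1).neg.div hd hs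
  have h1 := (hf.hasDirDeriv_ellLower hp 0).div hd hs
  revert i
  refine Fin.forall_fin_two.2 ⟨?_, ?_⟩
  · convert h0 using 1
    · rfl
    · simp only [Fin.sum_univ_two, berwaldM, Matrix.cons_val_zero, Matrix.cons_val_one]
      field_simp
      ring
  · convert h1 using 1
    · rfl
    · simp only [Fin.sum_univ_two, berwaldM, Matrix.cons_val_zero, Matrix.cons_val_one]
      field_simp
      ring

/-! ### Covariant derivatives of tensors along the spray -/

variable {T : Fin 2 → Fin 2 → Fin 2 → V 2 → V 2 → ℝ}

theorem smooth_cartan (hf : IsLocalMetric f U) (i j k : Fin 2) :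
    SmoothOn (U ×ˢ {0}ᶜ) (cartan f i j k) :=
  (smoothOn_const _).mul ((hf.smooth_fundamentalTensor i j).dY hf.isOpen_slit k)

theorem smooth_covDeriv (hf : IsLocalMetric f U)
    (hT : ∀ i j k, SmoothOn (U ×ˢ {0}ᶜ) (T i j k)) (i j k l : Fin 2) :
    SmoothOn (U ×ˢ {0}ᶜ) (covDeriv f T i j k l) := by
  have hΓ := hf.smooth_berwaldConn
  refine (((hf.smooth_horiz (hT i j k) l).sub ?_).sub ?_).sub ?_ <;>
  exact SmoothOn.sum _ fun m _ => (hΓ _ _ _).mul (hT _ _ _)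

theorem smooth_sprayCovDeriv (hf : IsLocalMetric f U)
    (hT : ∀ i j k, SmoothOn (U ×ˢ {0}ᶜ) (T i j k)) (i j k : Fin 2) :
    SmoothOn (U ×ˢ {0}ᶜ) (sprayCovDeriv f T i j k) :=
  SmoothOn.sum _ fun s _ => (hf.smooth_covDeriv hT i j k s).mul (smoothOn_velocity s)

theorem smooth_landsberg (hf : IsLocalMetric f U) (i j k : Fin 2) :
    SmoothOn (U ×ˢ {0}ᶜ) (landsberg f i j k) :=
  hf.smooth_sprayCovDeriv hf.smooth_cartan i j k

/-- Along the spray, the Berwald connection reduces to the nonlinear connection. -/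
theorem sprayCovDeriv_eq (hf : IsLocalMetric f U) {x y : V 2} (hp : (x, y) ∈ U ×ˢ {0}ᶜ)
    (i j k : Fin 2) :
    sprayCovDeriv f T i j k x y = sprayDeriv f (T i j k) x y
      - ∑ m, (nonlinConn f m i x y * T m j k x y + nonlinConn f m j x y * T i m k x y +
        nonlinConn f m k x y * T i j m x y) := by
  have hN : ∀ m a, nonlinConn f m a x y =
      y 0 * berwaldConn f m a 0 x y + y 1 * berwaldConn f m a 1 x y := fun m a => by
    rw [← hf.berwaldConn_velocity hp m a, Fin.sum_univ_two, hf.berwaldConn_symm hp m 0,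
      hf.berwaldConn_symm hp m 1]
  simp only [sprayCovDeriv, sprayDeriv, covDeriv, Fin.sum_univ_two, hN]
  ring

/-- As `F` and `m` are parallel along the spray, differentiating the component `F T(m, m, m)`
amounts to differentiating `T` covariantly. -/
theorem hasDirDeriv_frameComponent (hf : IsLocalMetric f U)
    (hT : ∀ i j k, SmoothOn (U ×ˢ {0}ᶜ) (T i j k)) {x y : V 2} (hp : (x, y) ∈ U ×ˢ {0}ᶜ) :
    HasDirDeriv (frameComponent f T) x y y (sprayVelocity f x y)
      (frameComponent f (sprayCovDeriv f T) x y) := by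
  have hm := hf.hasDirDeriv_berwaldM hp
  have h1 : HasDirDeriv (frameComponent f T) x y y (sprayVelocity f x y) _ :=
    (hf.hasDirDeriv_self hp).mul <| HasDirDeriv.sum Finset.univ fun i _ =>
      HasDirDeriv.sum Finset.univ fun j _ => HasDirDeriv.sum Finset.univ fun k _ =>
        (((hf.hasDirDeriv_sprayDeriv hf.isOpen_slit subset_rfl (hT i j k) hp).mul (hm i)).mul
          (hm j)).mul (hm k)
  convert h1 using 1
  simp only [frameComponent, hf.sprayCovDeriv_eq hp, Fin.sum_univ_two]
  ring

theorem smooth_frameComponent (hf : IsLocalMetric f U)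
    (hT : ∀ i j k, SmoothOn (U ×ˢ {0}ᶜ) (T i j k)) :
    SmoothOn (U ×ˢ {0}ᶜ) (frameComponent f T) := by
  have hm := hf.smooth_berwaldM
  exact hf.smooth.mul <| SmoothOn.sum _ fun i _ => SmoothOn.sum _ fun j _ => SmoothOn.sum _
    fun k _ => (((hT i j k).mul (hm i)).mul (hm j)).mul (hm k)

theorem sprayDeriv_frameComponent (hf : IsLocalMetric f U)
    (hT : ∀ i j k, SmoothOn (U ×ˢ {0}ᶜ) (T i j k)) {x y : V 2} (hp : (x, y) ∈ U ×ˢ {0}ᶜ) :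
    sprayDeriv f (frameComponent f T) x y = frameComponent f (sprayCovDeriv f T) x y :=
  HasDerivAt.unique (hf.hasDirDeriv_sprayDeriv hf.isOpen_slit subset_rfl
    (hf.smooth_frameComponent hT) hp) (hf.hasDirDeriv_frameComponent hT hp)

/-! ### Contractions with the velocity -/

/-- If a tensor is annihilated by the velocity in its last slot, so are its covariant
derivatives. -/
theorem covDeriv_velocity (hf : IsLocalMetric f U)
    (hT : ∀ i j k, SmoothOn (U ×ˢ {0}ᶜ) (T i j k))
    (h0 : ∀ i j x y, (x, y) ∈ U ×ˢ {0}ᶜ → ∑ k, T i j k x y * y k = 0)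
    {x y : V 2} (hp : (x, y) ∈ U ×ˢ {0}ᶜ) (i j l : Fin 2) :
    ∑ k, covDeriv f T i j k l x y * y k = 0 := by
  have hW := hf.isOpen_slit
  have h1 := HasDirDeriv.eq_of_eqOn hW (h0 i j) hp
    (HasDirDeriv.sum Finset.univ fun k _ => ((hT i j k).hasDirDeriv_horiz f hW hp l).mul
      (hasDirDeriv_velocity x y _ _ k)) (hasDirDeriv_const x y _ _ 0)
  have a0 := h0 0 j x y hp
  have a1 := h0 1 j x y hp
  have b0 := h0 i 0 x y hp
  have b1 := h0 i 1 x y hp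
  have n0 := hf.berwaldConn_velocity hp 0 l
  have n1 := hf.berwaldConn_velocity hp 1 l
  simp only [covDeriv, Fin.sum_univ_two] at *
  linear_combination h1 - berwaldConn f 0 i l x y * a0 - berwaldConn f 1 i l x y * a1
    - berwaldConn f 0 j l x y * b0 - berwaldConn f 1 j l x y * b1
    - T i j 0 x y * n0 - T i j 1 x y * n1

theorem cartan_velocity (hf : IsLocalMetric f U) {x y : V 2} (hp : (x, y) ∈ U ×ˢ {0}ᶜ)
    (i j : Fin 2) : ∑ k, cartan f i j k x y * y k = 0 := by
  have := (hf.homogeneous_fundamentalTensor i j).euler hf.isOpen_slit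
    (hf.smooth_fundamentalTensor i j) hp
  simp only [cartan, Fin.sum_univ_two] at *
  push_cast at this
  linear_combination this / 2

theorem landsberg_velocity (hf : IsLocalMetric f U) {x y : V 2} (hp : (x, y) ∈ U ×ˢ {0}ᶜ)
    (i j : Fin 2) : ∑ k, landsberg f i j k x y * y k = 0 := by
  have h := hf.covDeriv_velocity hf.smooth_cartan (fun i j x y hp => hf.cartan_velocity hp i j)
    hp i j
  have h0 := h 0
  have h1 := h 1
  simp only [landsberg, Fin.sum_univ_two] at *
  linear_combination y 0 * h0 + y 1 * h1

/-- The stretch equation contracted with the velocity in its last slot is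
`2 L_{ijk|s} yˢ = c F L_ijk`. -/
theorem sprayCovDeriv_landsberg (hf : IsLocalMetric f U) {x y : V 2} (hp : (x, y) ∈ U ×ˢ {0}ᶜ)
    {c : ℝ} (hc : ∀ i j k l : Fin 2, stretch f i j k l x y =
      c * f x y * (covDeriv f (cartan f) i j k l x y - covDeriv f (cartan f) i j l k x y))
    (i j k : Fin 2) :
    2 * sprayCovDeriv f (landsberg f) i j k x y = c * f x y * landsberg f i j k x y := by
  have h1 := hf.covDeriv_velocity hf.smooth_cartan (fun i j x y hp => hf.cartan_velocity hp i j)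
    hp i j k
  have h2 := hf.covDeriv_velocity hf.smooth_landsberg
    (fun i j x y hp => hf.landsberg_velocity hp i j) hp i j k
  have c0 := hc i j k 0
  have c1 := hc i j k 1
  simp only [stretch, sprayCovDeriv, Fin.sum_univ_two] at *
  have h3 : landsberg f i j k x y =
      covDeriv f (cartan f) i j k 0 x y * y 0 + covDeriv f (cartan f) i j k 1 x y * y 1 := by
    simp [landsberg, Fin.sum_univ_two]
  rw [h3]
  linear_combination y 0 * c0 + y 1 * c1 + 2 * h2 - c * f x y * h1

/-- `2 I_{|1|1} = c I_{|1}` in terms of `μ = I_{|1} / I`. -/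
theorem stretchExpr_eq_zero (hf : IsLocalMetric f U) {x y : V 2} (hp : (x, y) ∈ U ×ˢ {0}ᶜ)
    {c : ℝ} (hc : ∀ i j k l : Fin 2, stretch f i j k l x y =
      c * f x y * (covDeriv f (cartan f) i j k l x y - covDeriv f (cartan f) i j l k x y))
    (hI : principalScalar f x y ≠ 0) : stretchExpr f c x y = 0 := by
  have hW := hf.isOpen_slit
  have hIs : SmoothOn (U ×ˢ {0}ᶜ) (principalScalar f) := hf.smooth_frameComponent hf.smooth_cartan
  have hJs := hf.smooth_frameComponent hf.smooth_landsberg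
  -- `μ` is smooth only on the open set `I ≠ 0`
  let W' : Set (V 2 × V 2) := {p ∈ U ×ˢ {0}ᶜ | Function.uncurry (principalScalar f) p ≠ 0}
  have hW'W : W' ⊆ U ×ˢ {0}ᶜ := fun p hp => hp.1
  have hW' : IsOpen W' :=
    ContinuousOn.isOpen_inter_preimage (ContDiffOn.continuousOn hIs) hW isOpen_compl_singleton
  have hp' : (x, y) ∈ W' := ⟨hp, hI⟩
  have hμ : ∀ x y, (x, y) ∈ U ×ˢ {0}ᶜ → logDerivScalar f x y =
      frameComponent f (landsberg f) x y / (principalScalar f x y * f x y) := by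
    intro x y hp
    have h1 : sprayDeriv f (principalScalar f) x y = frameComponent f (landsberg f) x y :=
      hf.sprayDeriv_frameComponent hf.smooth_cartan hp
    rw [← h1]
    simp only [logDerivScalar, sprayDeriv, Fin.sum_univ_two, div_eq_mul_inv, mul_inv]
    ring
  have h0 : ∀ x y, (x, y) ∈ W' → principalScalar f x y * f x y ≠ 0 := fun x y hp =>
    mul_ne_zero hp.2 (hf.pos_of_mem hp.1).ne'
  have hμs : SmoothOn W' (logDerivScalar f) :=
    ((hJs.mono hW'W).div ((hIs.mono hW'W).mul (hf.smooth.mono hW'W)) h0).congr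
      fun x y hp => hμ x y hp.1
  have hJ := hf.hasDirDeriv_frameComponent hf.smooth_landsberg hp
  have hI' : HasDirDeriv (principalScalar f) x y y (sprayVelocity f x y)
    (frameComponent f (landsberg f) x y) := hf.hasDirDeriv_frameComponent hf.smooth_cartan hp
  have hμ' : logDerivScalar' f x y = _ := HasDirDeriv.eq_of_eqOn hW' (fun x y h => hμ x y h.1) hp'
    (hf.hasDirDeriv_sprayDeriv hW' hW'W hμs hp')
    (hJ.div (hI'.mul (hf.hasDirDeriv_self hp)) (h0 x y hp'))
  have hkey : 2 * frameComponent f (sprayCovDeriv f (landsberg f)) x y =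
      c * f x y * frameComponent f (landsberg f) x y := by
    have := hf.sprayCovDeriv_landsberg hp hc
    have h' : ∀ i j k, sprayCovDeriv f (landsberg f) i j k x y =
        c * f x y * landsberg f i j k x y / 2 := fun i j k => by linarith [this i j k]
    simp only [frameComponent, h', Fin.sum_univ_two]
    ring
  have hF := (hf.pos_of_mem hp).ne'
  rw [stretchExpr, hμ', hμ x y hp]
  have hd : frameComponent f (sprayCovDeriv f (landsberg f)) x y =
      c * f x y * frameComponent f (landsberg f) x y / 2 := by linarith
  rw [hd]
  field_simp
  ring

/-! ### Vanishing of the principal scalar -/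

/-- In dimension two a Cartan torsion with vanishing principal scalar vanishes: it is totally
symmetric, it is annihilated by `y`, and `y` and `m` span the plane. -/
theorem cartan_eq_zero (hf : IsLocalMetric f U) {x y : V 2} (hp : (x, y) ∈ U ×ˢ {0}ᶜ)
    (hI : principalScalar f x y = 0) (i j k : Fin 2) : cartan f i j k x y = 0 := by
  have hs : ∀ i j k, cartan f i j k x y = cartan f j i k x y := fun i j k =>
    congrArg (fun a => (1 / 2 : ℝ) * a) (hf.dY_fundamentalTensor_symm hp i j k)
  have hc : ∀ i j k, cartan f i j k x y = cartan f j k i x y := fun i j k =>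
    congrArg (fun a => (1 / 2 : ℝ) * a) (hf.dY_fundamentalTensor_cycle hp i j k)
  have v00 := hf.cartan_velocity hp 0 0
  have v01 := hf.cartan_velocity hp 0 1
  have v11 := hf.cartan_velocity hp 1 1
  have hF := hf.pos_of_mem hp
  have hd := Real.sqrt_pos.2 (hf.det_pos_of_mem hp)
  -- `y ∧ m = F / √(det g)`, by Euler's relation `ℓ_i yⁱ = F`
  have hw : y 0 * berwaldM f x y 1 - y 1 * berwaldM f x y 0 = f x y / √((gMatrix f x y).det) := by
    have he := hf.energy_eq hp
    simp only [berwaldM, ellLower, Fin.sum_univ_two, Matrix.cons_val_zero,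
      Matrix.cons_val_one] at *
    field_simp
    linear_combination -he
  have hw0 : y 0 * berwaldM f x y 1 - y 1 * berwaldM f x y 0 ≠ 0 := by
    rw [hw]; positivity
  have e010 : cartan f 0 1 0 x y = cartan f 0 0 1 x y := by rw [hs, hc 1 0 0]
  have e100 : cartan f 1 0 0 x y = cartan f 0 0 1 x y := hc 1 0 0
  have e101 : cartan f 1 0 1 x y = cartan f 0 1 1 x y := hc 1 0 1
  have e110 : cartan f 1 1 0 x y = cartan f 0 1 1 x y := by rw [hc, e101]
  have hS : ∑ i, ∑ j, ∑ k, cartan f i j k x y *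
      berwaldM f x y i * berwaldM f x y j * berwaldM f x y k = 0 :=
    (mul_eq_zero.1 hI).resolve_left hF.ne'
  simp only [Fin.sum_univ_two, e010, e100, e101, e110] at v00 v01 v11 hS
  generalize ha : cartan f 0 0 0 x y = a at v00 v01 v11 hS
  generalize hb : cartan f 0 0 1 x y = b at v00 v01 v11 hS
  generalize hc' : cartan f 0 1 1 x y = c at v00 v01 v11 hS
  generalize hd' : cartan f 1 1 1 x y = d at v00 v01 v11 hS
  generalize berwaldM f x y 0 = p at hS hw0
  generalize berwaldM f x y 1 = q at hS hw0
  have key : ∀ t u : ℝ, t * (y 0 * q - y 1 * p) = u → u = 0 → t = 0 := fun t u h hu =>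
    (mul_eq_zero.1 (h.trans hu)).resolve_right hw0
  -- the contractions with two, one and no factors `m` vanish successively
  have r0 : a * p * p + 2 * b * p * q + c * q * q = 0 :=
    key _ (-y 1 * (a * p * p * p + 3 * b * p * p * q + 3 * c * p * q * q + d * q * q * q))
      (by linear_combination p * p * q * v00 + 2 * p * q * q * v01 + q * q * q * v11)
      (by linear_combination -y 1 * hS)
  have r1 : b * p * p + 2 * c * p * q + d * q * q = 0 :=
    key _ (y 0 * (a * p * p * p + 3 * b * p * p * q + 3 * c * p * q * q + d * q * q * q))
      (by linear_combination -p * p * p * v00 - 2 * p * p * q * v01 - p * q * q * v11)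
      (by linear_combination y 0 * hS)
  have s0 : a * p + b * q = 0 := key _ (-y 1 * (a * p * p + 2 * b * p * q + c * q * q))
    (by linear_combination p * q * v00 + q * q * v01) (by rw [r0, mul_zero])
  have s1 : b * p + c * q = 0 := key _ (-y 1 * (b * p * p + 2 * c * p * q + d * q * q))
    (by linear_combination p * q * v01 + q * q * v11) (by rw [r1, mul_zero])
  have s2 : c * p + d * q = 0 := key _ (y 0 * (b * p * p + 2 * c * p * q + d * q * q))
    (by linear_combination -p * p * v01 - p * q * v11) (by rw [r1, mul_zero])
  have ha0 : a = 0 := key _ (-y 1 * (a * p + b * q)) (by linear_combination q * v00)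
    (by rw [s0, mul_zero])
  have hb0 : b = 0 := key _ (-y 1 * (b * p + c * q)) (by linear_combination q * v01)
    (by rw [s1, mul_zero])
  have hc0 : c = 0 := key _ (-y 1 * (c * p + d * q)) (by linear_combination q * v11)
    (by rw [s2, mul_zero])
  have hd0 : d = 0 := key _ (y 0 * (c * p + d * q)) (by linear_combination -p * v11)
    (by rw [s2, mul_zero])
  revert i j k
  simp [Fin.forall_fin_two, e010, e100, e101, e110, ha, hb, hc', hd', ha0, hb0, hc0, hd0]

/-- If the principal scalar vanishes over the point `x`, then `F²` is a quadratic form there: the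
components `g_ij` are constant on the punctured plane, which is connected. -/
theorem exists_quadratic (hf : IsLocalMetric f U) {x : V 2} (hx : x ∈ U)
    (hI : ∀ y : V 2, y ≠ 0 → principalScalar f x y = 0) :
    ∃ a : Fin 2 → Fin 2 → ℝ, ∀ y : V 2, f x y ^ 2 = ∑ i, ∑ j, a i j * y i * y j := by
  have hconn : IsConnected ({0}ᶜ : Set (V 2)) :=
    isConnected_compl_singleton_of_one_lt_rank (by
      rw [← Module.finrank_eq_rank]; simp) 0
  have hmem : ∀ y : V 2, y ≠ 0 → (x, y) ∈ U ×ˢ ({0}ᶜ : Set (V 2)) := fun y hy => ⟨hx, hy⟩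
  have hconst : ∀ i j, ∀ y z : V 2, y ≠ 0 → z ≠ 0 →
      fundamentalTensor f i j x y = fundamentalTensor f i j x z := by
    intro i j y z hy hz
    refine IsOpen.is_const_of_fderiv_eq_zero (𝕜 := ℝ) (f := fun y => fundamentalTensor f i j x y)
      isOpen_compl_singleton hconn.isPreconnected ?_ ?_ hy hz
    · intro w hw
      have h1 := uncurry_hasFDerivAt hf.isOpen_slit (hf.smooth_fundamentalTensor i j) (hmem w hw)
      exact (h1.comp w (hasFDerivAt_prodMk_right x w)).differentiableAt.differentiableWithinAt
    · intro w hw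
      have h1 : ∀ k, fderiv ℝ (fun y => fundamentalTensor f i j x y) w
          (EuclideanSpace.single k 1) = 0 := fun k => by
        have : (1 / 2 : ℝ) * dY k (fundamentalTensor f i j) x w = 0 :=
          hf.cartan_eq_zero (hmem w hw) (hI w hw) i j k
        exact (mul_eq_zero.1 this).resolve_left (by norm_num)
      refine ContinuousLinearMap.coe_injective
        ((EuclideanSpace.basisFun (Fin 2) ℝ).toBasis.ext fun k => ?_)
      simpa using h1 k
  obtain ⟨z, hz⟩ : ∃ z : V 2, z ≠ 0 := exists_ne 0
  refine ⟨fun i j => fundamentalTensor f i j x z, fun y => ?_⟩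
  by_cases hy : y = 0
  · have h0 : f x 0 = 0 := by
      have := hf.homogeneous x 0 2 two_pos
      simp only [smul_zero, pow_one] at this
      linarith
    simp [hy, h0]
  · rw [hf.energy_eq (hmem y hy)]
    simp only [hconst _ _ y z hy hz]

end IsLocalMetric

/-- If `F²` is a quadratic form over the point `x`, then `g_ij` does not depend on `y` and the
principal scalar vanishes there. -/
theorem principalScalar_eq_zero_of_quadratic {f : V 2 → V 2 → ℝ} {x : V 2}
    (B : V 2 →L[ℝ] V 2 →L[ℝ] ℝ) (hB : ∀ y, f x y ^ 2 = B y y) (y : V 2) :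
    principalScalar f x y = 0 := by
  have h1 : ∀ j y, dY j (fun x' y' => f x' y' ^ 2) x y =
      B y (EuclideanSpace.single j 1) + B (EuclideanSpace.single j 1) y := by
    intro j y
    simp only [dY, hB]
    have := B.hasFDerivAt_of_bilinear (hasFDerivAt_id y) (hasFDerivAt_id y)
    rw [show (fun z => (B z) z) = fun z => B (id z) (id z) from rfl, this.fderiv]
    simp
  have h2 : ∀ i j y, fundamentalTensor f i j x y = 1 / 2 *
      (B (EuclideanSpace.single i 1) (EuclideanSpace.single j 1) +
        B (EuclideanSpace.single j 1) (EuclideanSpace.single i 1)) := by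
    intro i j y
    unfold fundamentalTensor
    rw [dY]
    simp only [h1]
    congr 1
    have h3 : HasFDerivAt (fun z => B z (EuclideanSpace.single j 1) +
        B (EuclideanSpace.single j 1) z) (B.flip (EuclideanSpace.single j 1) +
        B (EuclideanSpace.single j 1)) y :=
      (B.flip (EuclideanSpace.single j 1)).hasFDerivAt.add
        (B (EuclideanSpace.single j 1)).hasFDerivAt
    rw [h3.fderiv]
    simp
  have h3 : ∀ i j k, cartan f i j k x y = 0 := by
    intro i j k
    simp [cartan, dY, h2]
  simp [principalScalar, h3]

/-! ### Finsler metrics in charts -/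

/-- The definition of `IsLocalMetric` in terms of second derivatives of `F²` along lines. -/
theorem IsLocalMetric.of_posDef {f : V 2 → V 2 → ℝ} {U : Set (V 2)} (hU : IsOpen U)
    (hs : SmoothOn (U ×ˢ {0}ᶜ) f) (hh : Homogeneous 1 f)
    (hpos : ∀ x ∈ U, ∀ y : V 2, y ≠ 0 → 0 < f x y)
    (hdef : ∀ x ∈ U, ∀ y u : V 2, y ≠ 0 → u ≠ 0 →
      0 < (1 / 2 : ℝ) * deriv (fun s : ℝ => deriv (fun t : ℝ =>
        f x (y + s • u + t • u) ^ 2) 0) 0) : IsLocalMetric f U := by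
  refine ⟨hU, hs, hh, hpos, fun x hx y hy => ?_⟩
  have hW : IsOpen (U ×ˢ ({0}ᶜ : Set (V 2))) := hU.prod isOpen_compl_singleton
  have hQ : SmoothOn (U ×ˢ {0}ᶜ) (energy f) := ContDiffOn.pow hs 2
  have hp : (x, y) ∈ U ×ˢ ({0}ᶜ : Set (V 2)) := ⟨hx, hy⟩
  -- the iterated derivative of `F²` along `u` is `2 g_ij uⁱ uʲ`
  have hg : ∀ u : V 2, u ≠ 0 → 0 < ∑ i, ∑ j, fundamentalTensor f i j x y * u i * u j := by
    intro u hu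
    have h1 := hdef x hx y u hy hu
    have h2 : (fun s : ℝ => deriv (fun t : ℝ => f x (y + s • u + t • u) ^ 2) 0) =ᶠ[nhds 0]
        fun s => ∑ j, u j * dY j (energy f) (x + s • (0 : V 2)) (y + s • u) := by
      have hc : Continuous fun s : ℝ => y + s • u := by fun_prop
      have : ∀ᶠ s : ℝ in nhds 0, y + s • u ∈ ({0}ᶜ : Set (V 2)) :=
        hc.continuousAt.eventually_mem (isOpen_compl_singleton.mem_nhds (by simpa using hy))
      filter_upwards [this] with s hs
      have h3 : HasDerivAt _ _ _ := hQ.hasDirDeriv hW (x := x) (y := y + s • u) ⟨hx, hs⟩ 0 u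
      simpa [energy] using h3.deriv
    rw [h2.deriv_eq] at h1
    have h4 : HasDirDeriv (fun x y => ∑ j, u j * dY j (energy f) x y) x y 0 u _ :=
      HasDirDeriv.sum Finset.univ fun j _ => (hasDirDeriv_const x y _ _ (u j)).mul
        ((hQ.dY hW j).hasDirDeriv hW hp 0 u)
    rw [HasDerivAt.deriv h4] at h1
    have h5 : ∀ i j, fundamentalTensor f i j x y = 1 / 2 * dY i (dY j (energy f)) x y :=
      fun i j => rfl
    simp only [h5, Fin.sum_univ_two] at *
    simp at h1
    linarith
  have hsymm : fundamentalTensor f 0 1 x y = fundamentalTensor f 1 0 x y :=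
    congrArg (fun a => (1 / 2 : ℝ) * a) (dY_comm hW hQ hp 0 1)
  have h00 : 0 < fundamentalTensor f 0 0 x y := by
    have := hg (EuclideanSpace.single 0 1) (by simp)
    simpa [Fin.sum_univ_two] using this
  -- on the vector `(-g₀₁, g₀₀)` the form takes the value `g₀₀ det g`
  have h2 := hg !₂[-fundamentalTensor f 0 1 x y, fundamentalTensor f 0 0 x y] (by
    intro h
    have := congrArg (fun v : V 2 => v 1) h
    simp at this
    exact h00.ne' this)
  rw [gMatrix_det]
  simp [Fin.sum_univ_two] at h2
  rw [hsymm] at h2 ⊢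
  refine pos_of_mul_pos_right (a := fundamentalTensor f 0 0 x y) ?_ h00.le
  linarith

theorem mdifferentiable_of_mem_maximalAtlas {M : Type*} [TopologicalSpace M] {n : ℕ}
    [ChartedSpace (EuclideanSpace ℝ (Fin n)) M]
    {φ : OpenPartialHomeomorph M (EuclideanSpace ℝ (Fin n))}
    (hφ : φ ∈ IsManifold.maximalAtlas (𝓡 n) ∞ M) : φ.MDifferentiable (𝓡 n) (𝓡 n) :=
  ⟨(contMDiffOn_of_mem_maximalAtlas hφ).mdifferentiableOn (by simp),
    (contMDiffOn_symm_of_mem_maximalAtlas hφ).mdifferentiableOn (by simp)⟩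

theorem mfderiv_symm_ne_zero {M : Type*} [TopologicalSpace M] {n : ℕ}
    [ChartedSpace (EuclideanSpace ℝ (Fin n)) M]
    {φ : OpenPartialHomeomorph M (EuclideanSpace ℝ (Fin n))}
    (hφ : φ ∈ IsManifold.maximalAtlas (𝓡 n) ∞ M) {x : V n} (hx : x ∈ φ.target)
    {y : V n} (hy : y ≠ 0) : mfderiv (𝓡 n) (𝓡 n) φ.symm x y ≠ 0 := by
  have hinj := (mdifferentiable_of_mem_maximalAtlas hφ).symm.mfderiv_injective hx
  intro h
  exact hy (hinj (h.trans (map_zero _).symm))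

namespace FinslerMetric

variable {M : Type*} [TopologicalSpace M]

section General

variable {n : ℕ} [ChartedSpace (EuclideanSpace ℝ (Fin n)) M] [IsManifold (𝓡 n) ∞ M]

/-- If `F` vanished at `y`, it would vanish on the ray through `y`, against positive definiteness
at `y` in the direction `y`. -/
theorem toFun_pos (F : FinslerMetric n M) {x : M} {y : TangentSpace (𝓡 n) x} (hy : y ≠ 0) :
    0 < F.toFun ⟨x, y⟩ := by
  refine lt_of_le_of_ne (F.nonneg _) fun h => ?_
  have h1 := F.posDef x y y hy hy
  have h2 : ∀ s t : ℝ, -1 < s + t → F.toFun ⟨x, y + s • y + t • y⟩ = 0 := by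
    intro s t hst
    have : y + s • y + t • y = (1 + s + t) • y := by simp [add_smul]
    rw [this, F.homogeneous x y _ (by linarith), ← h, mul_zero]
  have h3 : (fun s : ℝ => deriv (fun t : ℝ => F.toFun ⟨x, y + s • y + t • y⟩ ^ 2) 0)
      =ᶠ[nhds 0] fun _ => 0 := by
    filter_upwards [Ioi_mem_nhds (show (-1 : ℝ) < 0 by norm_num)] with s hs
    have : (fun t : ℝ => F.toFun ⟨x, y + s • y + t • y⟩ ^ 2) =ᶠ[nhds 0] fun _ => 0 := by
      filter_upwards [Ioi_mem_nhds (show (-1 - s : ℝ) < 0 by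
        have := Set.mem_Ioi.1 hs; linarith)] with t ht
      rw [h2 s t (by have := Set.mem_Ioi.1 ht; linarith)]; simp
    rw [this.deriv_eq]; simp
  rw [h3.deriv_eq] at h1
  simp at h1

theorem inChart_homogeneous (F : FinslerMetric n M)
    (φ : OpenPartialHomeomorph M (EuclideanSpace ℝ (Fin n))) : Homogeneous 1 (F.inChart φ) := by
  intro x y r hr
  simp only [inChart, pow_one]
  rw [← F.homogeneous _ _ r hr]
  congr 2
  exact ContinuousLinearMap.map_smul _ r _

theorem inChart_smooth (F : FinslerMetric n M)
    {φ : OpenPartialHomeomorph M (EuclideanSpace ℝ (Fin n))}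
    (hφ : φ ∈ IsManifold.maximalAtlas (𝓡 n) ∞ M) :
    SmoothOn (φ.target ×ˢ {0}ᶜ) (F.inChart φ) := by
  have : IsManifold (𝓡 n) 1 M := .of_le (n := ∞) (by simp)
  have h1 := (contMDiffOn_symm_of_mem_maximalAtlas hφ).contMDiffOn_tangentMapWithin (m := ∞)
    (by simp) φ.open_target.uniqueMDiffOn
  have h2 : ContMDiff 𝓘(ℝ, V n × V n) (𝓡 n).tangent ∞
      (fun p : V n × V n => (⟨p.1, p.2⟩ : TangentBundle (𝓡 n) (V n))) := by
    intro p
    rw [Bundle.contMDiffAt_totalSpace]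
    refine ⟨contDiff_fst.contMDiff p, ?_⟩
    simpa using contDiff_snd.contMDiff p
  have h3 : ContMDiffOn 𝓘(ℝ, V n × V n) 𝓘(ℝ, ℝ) ∞ (fun p : V n × V n => F.toFun
      (tangentMapWithin (𝓡 n) (𝓡 n) φ.symm φ.target ⟨p.1, p.2⟩)) (φ.target ×ˢ {0}ᶜ) := by
    refine F.smooth.comp (h1.comp h2.contMDiffOn fun p hp => hp.1) fun p hp => ?_
    change mfderivWithin (𝓡 n) (𝓡 n) φ.symm φ.target p.1 p.2 ≠ 0
    rw [mfderivWithin_of_isOpen φ.open_target hp.1]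
    exact mfderiv_symm_ne_zero hφ hp.1 hp.2
  refine h3.contDiffOn.congr fun p hp => ?_
  simp only [Function.uncurry, inChart, tangentMapWithin]
  rw [mfderivWithin_of_isOpen φ.open_target hp.1]

end General

variable [ChartedSpace (EuclideanSpace ℝ (Fin 2)) M] [IsManifold (𝓡 2) ∞ M]

theorem inChart_isLocalMetric (F : FinslerMetric 2 M)
    {φ : OpenPartialHomeomorph M (EuclideanSpace ℝ (Fin 2))}
    (hφ : φ ∈ IsManifold.maximalAtlas (𝓡 2) ∞ M) : IsLocalMetric (F.inChart φ) φ.target := by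
  refine .of_posDef φ.open_target (F.inChart_smooth hφ) (F.inChart_homogeneous φ)
    (fun x hx y hy => F.toFun_pos (mfderiv_symm_ne_zero hφ hx hy)) fun x hx y u hy hu => ?_
  have h := F.posDef (φ.symm x) _ _ (mfderiv_symm_ne_zero hφ hx hy)
    (mfderiv_symm_ne_zero hφ hx hu)
  let A : V 2 →L[ℝ] TangentSpace (𝓡 2) (φ.symm x) := mfderiv (𝓡 2) (𝓡 2) φ.symm x
  have hA : ∀ s t : ℝ, A (y + s • u + t • u) = A y + s • A u + t • A u := fun s t => by simp
  change 0 < 1 / 2 * deriv (fun s => deriv (fun t =>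
    F.toFun ⟨φ.symm x, A (y + s • u + t • u)⟩ ^ 2) 0) 0
  simp only [hA]
  exact h

end FinslerMetric

/-! ### Riemannian metrics from fibrewise quadratic Finsler metrics -/

/-- The minimum of `B(v, v)` on the unit sphere bounds the unit ball of a definite form `B`. -/
theorem isVonNBounded_of_pos {n : ℕ} (B : V n →L[ℝ] V n →L[ℝ] ℝ)
    (hB : ∀ v : V n, v ≠ 0 → 0 < B v v) : Bornology.IsVonNBounded ℝ {v : V n | B v v < 1} := by
  rw [NormedSpace.isVonNBounded_iff]
  have hcont : Continuous fun v : V n => B v v := by fun_prop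
  -- the unit sphere is empty exactly in dimension zero
  rcases (Metric.sphere (0 : V n) 1).eq_empty_or_nonempty with he | hne
  · have h0 : ∀ v : V n, v = 0 := by
      intro v
      by_contra hv
      have : ‖v‖⁻¹ • v ∈ Metric.sphere (0 : V n) 1 := by
        simp [norm_smul, inv_mul_cancel₀ (norm_ne_zero_iff.2 hv)]
      rw [he] at this
      exact this
    exact (Bornology.isBounded_singleton (x := (0 : V n))).subset fun v _ => h0 v
  · obtain ⟨w, hw, hmin⟩ := (isCompact_sphere (0 : V n) 1).exists_isMinOn hne hcont.continuousOn
    have hw0 : w ≠ 0 := by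
      rintro rfl
      simp at hw
    have hc := hB w hw0
    have hle : ∀ v : V n, B w w * ‖v‖ ^ 2 ≤ B v v := by
      intro v
      by_cases hv : v = 0
      · simp [hv]
      · have hv' := norm_ne_zero_iff.2 hv
        have h1 : ‖v‖⁻¹ • v ∈ Metric.sphere (0 : V n) 1 := by
          simp [norm_smul, inv_mul_cancel₀ hv']
        have h2 : B w w ≤ B (‖v‖⁻¹ • v) (‖v‖⁻¹ • v) := hmin h1
        simp only [map_smul, smul_apply, smul_eq_mul] at h2
        calc B w w * ‖v‖ ^ 2 ≤ (‖v‖⁻¹ * (‖v‖⁻¹ * B v v)) * ‖v‖ ^ 2 := by gcongr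
          _ = B v v := by field_simp
    refine (Metric.isBounded_closedBall (x := (0 : V n)) (r := √(1 / B w w))).subset fun v hv => ?_
    rw [mem_closedBall_zero_iff]
    refine Real.le_sqrt_of_sq_le ?_
    rw [le_div_iff₀ hc, mul_comm]
    exact (hle v).trans (le_of_lt hv)

/-- A map into the continuous linear maps on a Euclidean space is smooth if its values on the
standard basis are. -/
theorem contMDiffAt_clm_of_single {M : Type*} [TopologicalSpace M] {n : ℕ}
    [ChartedSpace (EuclideanSpace ℝ (Fin n)) M] {E : Type*} [NormedAddCommGroup E]
    [NormedSpace ℝ E] {G : M → V n →L[ℝ] E} {x₀ : M}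
    (hG : ∀ i, ContMDiffAt (𝓡 n) 𝓘(ℝ, E) ∞ (fun x => G x (EuclideanSpace.single i 1)) x₀) :
    ContMDiffAt (𝓡 n) 𝓘(ℝ, V n →L[ℝ] E) ∞ G x₀ := by
  let Φ : (Fin n → E) → V n →L[ℝ] E := fun w =>
    ∑ i, (EuclideanSpace.proj i : V n →L[ℝ] ℝ).smulRight (w i)
  have hΦ : ContDiff ℝ ∞ Φ := by
    refine ContDiff.sum fun i _ => ?_
    exact (ContinuousLinearMap.smulRightL ℝ (V n) E (EuclideanSpace.proj i)).contDiff.comp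
      (contDiff_apply ℝ E i)
  have h1 : G = Φ ∘ fun x i => G x (EuclideanSpace.single i 1) := by
    funext x
    refine ContinuousLinearMap.coe_injective
      ((EuclideanSpace.basisFun (Fin n) ℝ).toBasis.ext fun k => ?_)
    simp [Φ]
  rw [h1]
  exact hΦ.contMDiff.contMDiffAt.comp x₀ (contMDiffAt_pi_space.2 hG)

namespace FinslerMetric

variable {M : Type*} [TopologicalSpace M] {n : ℕ}
  [ChartedSpace (EuclideanSpace ℝ (Fin n)) M] [IsManifold (𝓡 n) ∞ M]

/-- `F` is smooth along the nonzero vector fields that are constant in a trivialization of the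
tangent bundle. -/
theorem contMDiffOn_toFun_symm (F : FinslerMetric n M) (x₀ : M) {v : V n} (hv : v ≠ 0) :
    ContMDiffOn (𝓡 n) 𝓘(ℝ, ℝ) ∞
      (fun x => F.toFun ⟨x, (trivializationAt (V n) (TangentSpace (𝓡 n)) x₀).symm x v⟩)
      (trivializationAt (V n) (TangentSpace (𝓡 n) : M → Type _) x₀).baseSet := by
  set e := trivializationAt (V n) (TangentSpace (𝓡 n) : M → Type _) x₀
  refine F.smooth.comp (f := fun x => (⟨x, e.symm x v⟩ : TangentBundle (𝓡 n) M)) ?_ ?_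
  · have h1 : ContMDiffOn (𝓡 n) ((𝓡 n).prod 𝓘(ℝ, V n)) ∞ (fun x : M => (x, v)) e.baseSet :=
      contMDiffOn_id.prodMk contMDiffOn_const
    have h2 := (e.contMDiffOn_symm (n := ∞) (IB := 𝓡 n)).comp h1 fun x hx => e.mk_mem_target.2 hx
    exact h2.congr fun x hx => e.mk_symm hx v
  · intro x hx h
    have h1 := e.apply_mk_symm hx v
    have h2 := e.apply_mk_symm hx 0
    have h3 : e.symm x 0 = 0 := by
      rw [← e.symmL_apply (R := ℝ) hx, map_zero]
    have h4 : e.symm x v = 0 := h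
    rw [h4] at h1
    rw [h3] at h2
    exact hv (congrArg Prod.snd (h1.symm.trans h2))

/-- A Finsler metric whose square is a quadratic form on each fibre is Riemannian; the smoothness
of the metric follows by polarization. -/
theorem isRiemannian_of_bilinear (F : FinslerMetric n M)
    (B : ∀ x : M, TangentSpace (𝓡 n) x →L[ℝ] TangentSpace (𝓡 n) x →L[ℝ] ℝ)
    (hsymm : ∀ x v w, B x v w = B x w v)
    (hB : ∀ (x : M) (v : TangentSpace (𝓡 n) x), F.toFun ⟨x, v⟩ ^ 2 = B x v v) : F.IsRiemannian := by
  have hpos : ∀ x (v : TangentSpace (𝓡 n) x), v ≠ 0 → 0 < B x v v := fun x v hv => by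
    rw [← hB]; exact pow_pos (F.toFun_pos hv) 2
  refine ⟨⟨B, hsymm, hpos,
    fun x => isVonNBounded_of_pos (B x) (hpos x), ?_⟩, fun x y => ?_⟩
  · intro x₀
    rw [Bundle.contMDiffAt_section]
    set e := trivializationAt (V n) (TangentSpace (𝓡 n) : M → Type _) x₀ with he
    have hx₀ : x₀ ∈ e.baseSet := FiberBundle.mem_baseSet_trivializationAt' x₀
    let q : M → V n → ℝ := fun x v => F.toFun ⟨x, e.symm x v⟩ ^ 2
    have hq : ∀ v : V n, v ≠ 0 → ContMDiffAt (𝓡 n) 𝓘(ℝ, ℝ) ∞ (fun x => q x v) x₀ := fun v hv =>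
      ((F.contMDiffOn_toFun_symm x₀ hv).contMDiffAt (e.open_baseSet.mem_nhds hx₀)).pow 2
    refine contMDiffAt_clm_of_single fun i => contMDiffAt_clm_of_single fun j => ?_
    have hij : (EuclideanSpace.single i 1 + EuclideanSpace.single j 1 : V n) ≠ 0 := by
      intro h
      have := congrArg (fun v : V n => v i) h
      by_cases hij : i = j <;> simp [hij] at this
    have hsum := ((hq _ hij).sub (hq (EuclideanSpace.single i 1) (by simp))).sub
      (hq (EuclideanSpace.single j 1) (by simp))
    have hsum' : ContMDiffAt (𝓡 n) 𝓘(ℝ, ℝ) ∞ (fun x =>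
        1 / 2 * (q x (EuclideanSpace.single i 1 + EuclideanSpace.single j 1)
          - q x (EuclideanSpace.single i 1) - q x (EuclideanSpace.single j 1))) x₀ :=
      ContMDiffAt.mul contMDiffAt_const hsum
    refine hsum'.congr_of_eventuallyEq ?_
    filter_upwards [e.open_baseSet.mem_nhds hx₀] with x hx
    have hsym : ∀ v : V n, e.symm x v = e.symmL ℝ x v := fun v => (e.symmL_apply hx v).symm
    -- polarization of `F²(x, v) = B_x(v, v)`
    have hpol : ∀ v w : V n, B x (e.symm x v) (e.symm x w) =
        1 / 2 * (q x (v + w) - q x v - q x w) := fun v w => by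
      simp only [q, hB, hsym, map_add, add_apply, hsymm x (e.symmL ℝ x w)]
      ring
    change ContinuousLinearMap.inCoordinates (V n) (TangentSpace (𝓡 n)) (V n →L[ℝ] ℝ)
      (fun x : M => TangentSpace (𝓡 n) x →L[ℝ] ℝ) x₀ x x₀ x (B x)
        (EuclideanSpace.single i 1) (EuclideanSpace.single j 1) = _
    rw [inCoordinates_apply_eq₂ hx hx (Set.mem_univ _), ← hpol]
    simp [e]
  · rw [← Real.sqrt_sq (F.nonneg ⟨x, y⟩)]
    exact congrArg Real.sqrt (hB x y)

/-- The coordinate expression of `F` recovers `F` from the components of a tangent vector. -/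
theorem inChart_mfderiv (F : FinslerMetric n M)
    {φ : OpenPartialHomeomorph M (EuclideanSpace ℝ (Fin n))}
    (hφ : φ ∈ IsManifold.maximalAtlas (𝓡 n) ∞ M) {x : M} (hx : x ∈ φ.source)
    (v : TangentSpace (𝓡 n) x) :
    F.inChart φ (φ x) (mfderiv (𝓡 n) (𝓡 n) φ x v) = F.toFun ⟨x, v⟩ := by
  have h1 := (mdifferentiable_of_mem_maximalAtlas hφ).symm_comp_deriv hx
  have h2 : mfderiv (𝓡 n) (𝓡 n) φ.symm (φ x) (mfderiv (𝓡 n) (𝓡 n) φ x v) = v :=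
    congrArg (fun L => L v) h1
  have h3 : ∀ p : M, p = x → ∀ w : V n, F.toFun ⟨p, w⟩ = F.toFun ⟨x, w⟩ := by
    rintro p rfl w; rfl
  have h4 := h3 _ (φ.left_inv hx) (mfderiv (𝓡 n) (𝓡 n) φ.symm (φ x) (mfderiv (𝓡 n) (𝓡 n) φ x v))
  exact h4.trans (congrArg (fun w : V n => F.toFun ⟨x, w⟩) h2)

end FinslerMetric
end Finsler

theorem theorem1p3 {M : Type*} [TopologicalSpace M]
    [ChartedSpace (EuclideanSpace ℝ (Fin 2)) M] [IsManifold (𝓡 2) ∞ M]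
    (F : Finsler.FinslerMetric 2 M) (c : M → ℝ) (hc : F.HasRelativelyIsotropicStretch c) :
    (F.IsRiemannian ↔
      ∀ φ ∈ IsManifold.maximalAtlas (𝓡 2) ∞ M, ∀ x ∈ φ.target,
        ∀ y : EuclideanSpace ℝ (Fin 2), y ≠ 0 →
          Finsler.principalScalar (F.inChart φ) x y ≠ 0 →
            Finsler.stretchExpr (F.inChart φ) (c (φ.symm x)) x y ≠ 0) ∧
    (∀ φ ∈ IsManifold.maximalAtlas (𝓡 2) ∞ M, ∀ x ∈ φ.target,
      ∀ y : EuclideanSpace ℝ (Fin 2), y ≠ 0 →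
        Finsler.principalScalar (F.inChart φ) x y ≠ 0 →
          Finsler.stretchExpr (F.inChart φ) (c (φ.symm x)) x y = 0) := by
  have hzero : ∀ φ ∈ IsManifold.maximalAtlas (𝓡 2) ∞ M, ∀ x ∈ φ.target,
      ∀ y : EuclideanSpace ℝ (Fin 2), y ≠ 0 →
        Finsler.principalScalar (F.inChart φ) x y ≠ 0 →
          Finsler.stretchExpr (F.inChart φ) (c (φ.symm x)) x y = 0 := fun φ hφ x hx y hy hI =>
    (F.inChart_isLocalMetric hφ).stretchExpr_eq_zero ⟨hx, hy⟩ (hc φ hφ x hx y hy) hI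
  refine ⟨⟨?_, fun h => ?_⟩, hzero⟩
  · rintro ⟨a, ha⟩ φ hφ x hx y hy hI
    refine absurd (Finsler.principalScalar_eq_zero_of_quadratic ?_ ?_ y) hI
    · let A : Finsler.V 2 →L[ℝ] Finsler.V 2 := mfderiv (𝓡 2) (𝓡 2) φ.symm x
      let a' : Finsler.V 2 →L[ℝ] Finsler.V 2 →L[ℝ] ℝ := a.inner (φ.symm x)
      exact a'.bilinearComp A A
    · intro z
      have h0 : 0 ≤ a.inner (φ.symm x) (mfderiv (𝓡 2) (𝓡 2) φ.symm x z)
          (mfderiv (𝓡 2) (𝓡 2) φ.symm x z) := by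
        by_cases hz : mfderiv (𝓡 2) (𝓡 2) φ.symm x z = 0
        · rw [hz]; simp
        · exact (a.pos _ _ hz).le
      rw [Finsler.FinslerMetric.inChart, ha, Real.sq_sqrt h0]
      rfl
  · have hI : ∀ φ ∈ IsManifold.maximalAtlas (𝓡 2) ∞ M, ∀ x ∈ φ.target,
        ∀ y : EuclideanSpace ℝ (Fin 2), y ≠ 0 →
          Finsler.principalScalar (F.inChart φ) x y = 0 := fun φ hφ x hx y hy => by
      by_contra hI
      exact h φ hφ x hx y hy hI (hzero φ hφ x hx y hy hI)
    have hquad : ∀ x : M, ∃ B : Finsler.V 2 →L[ℝ] Finsler.V 2 →L[ℝ] ℝ,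
        (∀ v w, B v w = B w v) ∧ ∀ v : Finsler.V 2, F.toFun ⟨x, v⟩ ^ 2 = B v v := by
      intro x
      have hφ : chartAt (EuclideanSpace ℝ (Fin 2)) x ∈ IsManifold.maximalAtlas (𝓡 2) ∞ M :=
        IsManifold.chart_mem_maximalAtlas x
      have hx := mem_chart_source (EuclideanSpace ℝ (Fin 2)) x
      generalize chartAt (EuclideanSpace ℝ (Fin 2)) x = φ at hφ hx
      obtain ⟨a, ha⟩ := (F.inChart_isLocalMetric hφ).exists_quadratic (φ.map_source hx)
        (hI φ hφ _ (φ.map_source hx))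
      let A : Finsler.V 2 →L[ℝ] Finsler.V 2 := mfderiv (𝓡 2) (𝓡 2) φ x
      let L : Fin 2 → Finsler.V 2 →L[ℝ] ℝ := fun i => (EuclideanSpace.proj i).comp A
      refine ⟨∑ i, ∑ j, ((a i j + a j i) / 2) • (L i).smulRight (L j), fun v w => ?_, fun v => ?_⟩
      · simp [Fin.sum_univ_two]
        ring
      · have h1 : F.inChart φ (φ x) (A v) = F.toFun ⟨x, v⟩ := F.inChart_mfderiv hφ hx v
        rw [← h1, ha]
        simp [Fin.sum_univ_two, L]
        ring
    choose B hsymm hB using hquad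
    exact F.isRiemannian_of_bilinear B hsymm hB

end
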